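/- Let $K$ be a field and let $A=\bigoplus_{i\ge 0}A_i$ be a finite dimensional non-negatively graded $K$-algebra with Jacobson radical $J_A$. For $X$ a graded module write $X(i)$ for the shifted module with $X(i)_j=X_{i+j}$, and let $\operatorname{Ext}^n_A(X,Y)_0$ denote the extension groups in the category of $\mathbb Z$-graded modules with degree-preserving homomorphisms. For a finitely generated graded (right or left) $A$-module $M$ put $$g(M)=\sup\{\,i\in\mathbb Z \mid \operatorname{Ext}^n_A\big((A/J_A)(i),M\big)_0\neq 0\ \text{ for some } n\ge 0\,\},$$ and let $g(A)=g(A_A)$ (computed with right modules) and $g(A^{\mathrm{op}})=g({}_AA)$ (computed with left modules); the supremum is taken in the extended reals. Assume that $A$ is graded Iwanaga-Gorenstein, i.e. both $A_A$ and ${}_AA$ have finite graded injective dimension, and that $A_0$ has finite global dimension. Then $g(A)\le 0$ if and only if $g(A^{\mathrm{op}})\le 0$. -/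

import Mathlib

open CategoryTheory CategoryTheory.Limits

universe u v

noncomputable section

/-! ### A criterion for internal direct sums -/

/-- `M` is the internal direct sum of the `d i` as soon as every element is a finite sum of
homogeneous elements and finite sums of homogeneous elements of distinct degrees vanish only
trivially. -/
theorem isInternal_of_sums {M : Type*} [AddCommGroup M] {σ : Type*} [SetLike σ M]
    [AddSubgroupClass σ M] (d : ℤ → σ)
    (h1 : ∀ m : M, ∃ (s : Finset ℤ) (x : ℤ → M), (∀ i, x i ∈ d i) ∧ m = ∑ i ∈ s, x i)
    (h2 : ∀ (s : Finset ℤ) (x : ℤ → M), (∀ i, x i ∈ d i) → ∑ i ∈ s, x i = 0 →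
      ∀ i ∈ s, x i = 0) :
    DirectSum.IsInternal d := by
  classical
  refine ⟨?_, ?_⟩
  · rw [injective_iff_map_eq_zero]
    intro x hx
    rw [DirectSum.coeAddMonoidHom_eq_dfinsuppSum] at hx
    have := h2 (DFinsupp.support x) (fun i => (x i : M)) (fun i => (x i).2) hx
    ext i
    by_cases hi : i ∈ DFinsupp.support x
    · simpa using this i hi
    · simpa using hi
  · intro m
    obtain ⟨s, x, hx, rfl⟩ := h1 m
    refine ⟨∑ i ∈ s, DirectSum.of (fun i => d i) i ⟨x i, hx i⟩, ?_⟩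
    simp [map_sum]

/-! ### The category of graded modules -/

/-- A `ℤ`-graded left module over the graded algebra `A = ⨁ 𝒜 i`: an `A`-module `M` with additive
subgroups `M_j` such that `M = ⨁ M_j` and `A_i M_j ⊆ M_{i + j}`. -/
structure GrMod {K : Type u} {A : Type v} [Field K] [Ring A] [Algebra K A]
    (𝒜 : ℤ → Submodule K A) : Type (v + 1) where
  carrier : Type v
  [addCommGroup : AddCommGroup carrier]
  [module : Module A carrier]
  deg : ℤ → AddSubgroup carrier
  isInternal : DirectSum.IsInternal deg
  smul_mem : ∀ {i j : ℤ} {a : A} {m : carrier}, a ∈ 𝒜 i → m ∈ deg j → a • m ∈ deg (i + j)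

namespace GrMod

section

variable {K : Type u} {A : Type v} [Field K] [Ring A] [Algebra K A] {𝒜 : ℤ → Submodule K A}

attribute [instance] addCommGroup module

instance (M : GrMod 𝒜) : DirectSum.Decomposition M.deg := M.isInternal.chooseDecomposition

/-- The homogeneous component of degree `i` of an element of a graded module. -/
def proj (M : GrMod 𝒜) (i : ℤ) (m : M.carrier) : M.carrier := DirectSum.decompose M.deg m i

theorem proj_mem (M : GrMod 𝒜) (i : ℤ) (m : M.carrier) : M.proj i m ∈ M.deg i :=
  (DirectSum.decompose M.deg m i).2

theorem exists_sum (M : GrMod 𝒜) (m : M.carrier) : ∃ s : Finset ℤ, m = ∑ i ∈ s, M.proj i m := by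
  classical
  exact ⟨_, (DirectSum.sum_support_decompose M.deg m).symm⟩

theorem proj_sum (M : GrMod 𝒜) (s : Finset ℤ) (x : ℤ → M.carrier) (hx : ∀ i, x i ∈ M.deg i)
    (j : ℤ) : M.proj j (∑ i ∈ s, x i) = if j ∈ s then x j else 0 := by
  classical
  unfold proj
  rw [DirectSum.decompose_sum, DFinsupp.finsetSum_apply, AddSubgroup.val_finsetSum]
  rw [← Finset.sum_ite_eq s j x]
  refine Finset.sum_congr rfl fun i _ => ?_
  split_ifs with h
  · subst h
    exact DirectSum.decompose_of_mem_same _ (hx _)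
  · exact DirectSum.decompose_of_mem_ne _ (hx _) (Ne.symm h)

theorem eq_zero_of_sum (M : GrMod 𝒜) (s : Finset ℤ) (x : ℤ → M.carrier)
    (hx : ∀ i, x i ∈ M.deg i) (h : ∑ i ∈ s, x i = 0) : ∀ i ∈ s, x i = 0 := by
  intro i hi
  have := M.proj_sum s x hx i
  rw [h, if_pos hi] at this
  rw [← this]
  simp [proj]

theorem proj_of_mem (M : GrMod 𝒜) {i : ℤ} {m : M.carrier} (h : m ∈ M.deg i) : M.proj i m = m :=
  DirectSum.decompose_of_mem_same _ h

/-- The additive group `Hom_A(M, N)_0` of degree preserving `A`-linear maps. -/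
def homSubgroup (M N : GrMod 𝒜) : AddSubgroup (M.carrier →ₗ[A] N.carrier) where
  carrier := {f | ∀ i, ∀ m ∈ M.deg i, f m ∈ N.deg i}
  zero_mem' := fun i _ _ => (N.deg i).zero_mem
  add_mem' := fun hf hg i m hm => (N.deg i).add_mem (hf i m hm) (hg i m hm)
  neg_mem' := fun hf i m hm => (N.deg i).neg_mem (hf i m hm)

/-- The category `Mod^ℤ A` of graded modules with degree preserving `A`-linear maps. -/
instance : Category (GrMod 𝒜) where
  Hom M N := homSubgroup M N
  id M := ⟨LinearMap.id, fun _ _ h => h⟩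
  comp f g := ⟨g.1.comp f.1, fun i _ h => g.2 i _ (f.2 i _ h)⟩

/-- The underlying linear map of a morphism. -/
def lin {M N : GrMod 𝒜} (f : M ⟶ N) : M.carrier →ₗ[A] N.carrier := Subtype.val f

theorem lin_mem {M N : GrMod 𝒜} (f : M ⟶ N) {i : ℤ} {m : M.carrier} (h : m ∈ M.deg i) :
    lin f m ∈ N.deg i := Subtype.property f i m h

/-- A degree preserving linear map as a morphism. -/
def mkHom {M N : GrMod 𝒜} (f : M.carrier →ₗ[A] N.carrier)
    (h : ∀ i, ∀ m ∈ M.deg i, f m ∈ N.deg i) : M ⟶ N := (⟨f, h⟩ : homSubgroup M N)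

@[simp] theorem lin_mkHom {M N : GrMod 𝒜} (f : M.carrier →ₗ[A] N.carrier)
    (h : ∀ i, ∀ m ∈ M.deg i, f m ∈ N.deg i) : lin (mkHom f h) = f := rfl

theorem hom_ext {M N : GrMod 𝒜} {f g : M ⟶ N} (h : ∀ m, lin f m = lin g m) : f = g :=
  Subtype.ext (LinearMap.ext h)

@[simp] theorem lin_id (M : GrMod 𝒜) (m : M.carrier) : lin (𝟙 M) m = m := rfl

@[simp] theorem lin_comp {M N P : GrMod 𝒜} (f : M ⟶ N) (g : N ⟶ P) (m : M.carrier) :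
    lin (f ≫ g) m = lin g (lin f m) := rfl

instance (M N : GrMod 𝒜) : AddCommGroup (M ⟶ N) :=
  inferInstanceAs (AddCommGroup (homSubgroup M N))

@[simp] theorem lin_zero {M N : GrMod 𝒜} (m : M.carrier) : lin (0 : M ⟶ N) m = 0 := rfl

@[simp] theorem lin_add {M N : GrMod 𝒜} (f g : M ⟶ N) (m : M.carrier) :
    lin (f + g) m = lin f m + lin g m := rfl

instance : Preadditive (GrMod 𝒜) where
  add_comp _ _ _ f f' g := hom_ext fun m => by simp
  comp_add _ _ _ f g g' := hom_ext fun m => by simp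

theorem proj_lin {M N : GrMod 𝒜} (f : M ⟶ N) (i : ℤ) (m : M.carrier) :
    N.proj i (lin f m) = lin f (M.proj i m) := by
  obtain ⟨s, hs⟩ := M.exists_sum m
  have h1 : lin f m = ∑ i ∈ s, lin f (M.proj i m) := by
    conv_lhs => rw [hs]
    rw [map_sum]
  rw [h1, N.proj_sum s (fun i => lin f (M.proj i m)) (fun i => lin_mem f (M.proj_mem i m))]
  split_ifs with hi
  · rfl
  · have := M.proj_sum s (fun i => M.proj i m) (fun i => M.proj_mem i m) i
    rw [← hs, if_neg hi] at this
    rw [this, map_zero]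

/-! ### Graded submodules and quotients -/

/-- A submodule is homogeneous if it contains the homogeneous components of its elements. -/
def IsHomog (M : GrMod 𝒜) (N : Submodule A M.carrier) : Prop :=
  ∀ m ∈ N, ∀ i, M.proj i m ∈ N

/-- A homogeneous submodule with the induced grading `N_i = N ∩ M_i`. -/
def sub (M : GrMod 𝒜) (N : Submodule A M.carrier) (hN : M.IsHomog N) : GrMod 𝒜 where
  carrier := N
  deg i := (M.deg i).comap N.subtype.toAddMonoidHom
  isInternal := by
    refine isInternal_of_sums _ (fun m => ?_) (fun s x hx h i hi => ?_)
    · obtain ⟨s, hs⟩ := M.exists_sum m.1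
      refine ⟨s, fun i => ⟨M.proj i m.1, hN _ m.2 i⟩, fun i => M.proj_mem i m.1, ?_⟩
      apply Subtype.ext
      rw [Submodule.coe_sum]
      exact hs
    · apply Subtype.ext
      refine M.eq_zero_of_sum s (fun i => (x i).1) hx ?_ i hi
      have := congrArg Subtype.val h
      rwa [Submodule.coe_sum] at this
  smul_mem := fun ha hm => M.smul_mem ha hm

/-- The quotient by a homogeneous submodule with the grading `(M/N)_i = image of M_i`. -/
def quot (M : GrMod 𝒜) (N : Submodule A M.carrier) (hN : M.IsHomog N) : GrMod 𝒜 where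
  carrier := M.carrier ⧸ N
  deg i := (M.deg i).map N.mkQ.toAddMonoidHom
  isInternal := by
    refine isInternal_of_sums _ (fun m => ?_) (fun s x hx h i hi => ?_)
    · obtain ⟨m, rfl⟩ := N.mkQ_surjective m
      obtain ⟨s, hs⟩ := M.exists_sum m
      refine ⟨s, fun i => N.mkQ (M.proj i m), fun i => ⟨_, M.proj_mem i m, rfl⟩, ?_⟩
      rw [← map_sum, ← hs]
    · choose y hy hyx using hx
      have h' : N.mkQ (∑ i ∈ s, y i) = 0 := by
        rw [map_sum, ← h]
        exact Finset.sum_congr rfl fun i _ => hyx i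
      have h3 := hN _ ((Submodule.Quotient.mk_eq_zero N).1 h') i
      rw [M.proj_sum s y hy, if_pos hi] at h3
      rw [← hyx i]
      exact (Submodule.Quotient.mk_eq_zero N).2 h3
  smul_mem := by
    rintro i j a _ ha ⟨m, hm, rfl⟩
    exact ⟨a • m, M.smul_mem ha hm, rfl⟩

/-- The degree shift `M(n)`, with `M(n)_i = M_{i + n}`. -/
def shift (M : GrMod 𝒜) (n : ℤ) : GrMod 𝒜 where
  carrier := M.carrier
  deg i := M.deg (i + n)
  isInternal := by
    refine isInternal_of_sums _ (fun m => ?_) (fun s x hx h i hi => ?_)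
    · obtain ⟨s, hs⟩ := M.exists_sum m
      refine ⟨s.map (Equiv.subRight n).toEmbedding, fun i => M.proj (i + n) m,
        fun i => M.proj_mem _ m, ?_⟩
      simpa using hs
    · have := M.eq_zero_of_sum (s.map (Equiv.addRight n).toEmbedding) (fun i => x (i - n))
        (fun i => by simpa using hx (i - n)) (by simpa using h) (i + n) (by simpa using hi)
      simpa using this
  smul_mem := fun {i j a m} ha hm => by
    rw [add_assoc]
    exact M.smul_mem ha hm

/-! ### The category of graded modules is abelian -/

theorem isHomog_ker {M N : GrMod 𝒜} (f : M ⟶ N) : M.IsHomog (LinearMap.ker (lin f)) := by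
  intro m hm i
  rw [LinearMap.mem_ker] at hm ⊢
  rw [← proj_lin, hm]
  simp [proj]

theorem isHomog_range {M N : GrMod 𝒜} (f : M ⟶ N) : N.IsHomog (LinearMap.range (lin f)) := by
  rintro _ ⟨m, rfl⟩ i
  exact ⟨M.proj i m, (proj_lin f i m).symm⟩

/-- The kernel of a morphism. -/
def kerObj {M N : GrMod 𝒜} (f : M ⟶ N) : GrMod 𝒜 := M.sub _ (isHomog_ker f)

/-- The inclusion of the kernel. -/
def kerι {M N : GrMod 𝒜} (f : M ⟶ N) : kerObj f ⟶ M :=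
  mkHom (LinearMap.ker (lin f)).subtype fun _ _ h => h

theorem kerι_comp {M N : GrMod 𝒜} (f : M ⟶ N) : kerι f ≫ f = 0 :=
  hom_ext fun m => LinearMap.mem_ker.1 m.2

/-- The kernel has the universal property. -/
def kerIsLimit {M N : GrMod 𝒜} (f : M ⟶ N) : IsLimit (KernelFork.ofι (kerι f) (kerι_comp f)) :=
  KernelFork.IsLimit.ofι _ _
    (fun {W} g hg => (mkHom (LinearMap.codRestrict _ (lin g)
        (fun w => LinearMap.mem_ker.2 (congrArg (fun h => lin h w) hg)))
        (fun _ _ h => lin_mem g h) : W ⟶ kerObj f))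
    (fun _ _ => rfl)
    (fun _ _ _ hm => hom_ext fun w => Subtype.ext (congrArg (fun h => lin h w) hm))

/-- The cokernel of a morphism. -/
def cokerObj {M N : GrMod 𝒜} (f : M ⟶ N) : GrMod 𝒜 := N.quot _ (isHomog_range f)

/-- The projection to the cokernel. -/
def cokerπ {M N : GrMod 𝒜} (f : M ⟶ N) : N ⟶ cokerObj f :=
  mkHom (LinearMap.range (lin f)).mkQ fun _ m h => ⟨m, h, rfl⟩

theorem comp_cokerπ {M N : GrMod 𝒜} (f : M ⟶ N) : f ≫ cokerπ f = 0 :=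
  hom_ext fun m => (Submodule.Quotient.mk_eq_zero _).2 ⟨m, rfl⟩

/-- The cokernel has the universal property. -/
def cokerIsColimit {M N : GrMod 𝒜} (f : M ⟶ N) :
    IsColimit (CokernelCofork.ofπ (cokerπ f) (comp_cokerπ f)) :=
  CokernelCofork.IsColimit.ofπ _ _
    (fun {W} g hg => (mkHom ((LinearMap.range (lin f)).liftQ (lin g)
        (by
          rintro _ ⟨m, rfl⟩
          exact LinearMap.mem_ker.2 (congrArg (fun h => lin h m) hg)))
        (by
          rintro i _ ⟨m, hm, rfl⟩
          exact lin_mem g hm) : cokerObj f ⟶ W))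
    (fun _ _ => rfl)
    (fun _ _ _ hm => hom_ext fun w => by
      obtain ⟨w, rfl⟩ := Submodule.mkQ_surjective _ w
      exact congrArg (fun h => lin h w) hm)

instance : HasKernels (GrMod 𝒜) where
  has_limit f := HasLimit.mk ⟨_, kerIsLimit f⟩

instance : HasCokernels (GrMod 𝒜) where
  has_colimit f := HasColimit.mk ⟨_, cokerIsColimit f⟩

/-- The zero graded module. -/
def zero : GrMod 𝒜 where
  carrier := PUnit
  deg _ := ⊤
  isInternal := isInternal_of_sums _ (fun _ => ⟨∅, 0, fun _ => trivial, rfl⟩)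
    (fun _ _ _ _ _ _ => rfl)
  smul_mem := fun _ _ => trivial

instance : HasZeroObject (GrMod 𝒜) where
  zero := ⟨zero,
    { unique_to := fun _ => ⟨⟨⟨0⟩, fun _ => hom_ext fun m => by
        rw [show m = 0 from rfl, map_zero, map_zero]⟩⟩
      unique_from := fun _ => ⟨⟨⟨0⟩, fun _ => hom_ext fun _ => rfl⟩⟩ }⟩

/-- The direct sum of two graded modules. -/
def prod (M N : GrMod 𝒜) : GrMod 𝒜 where
  carrier := M.carrier × N.carrier
  deg i := (M.deg i).prod (N.deg i)
  isInternal := by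
    classical
    refine isInternal_of_sums _ (fun m => ?_) (fun s x hx h i hi => ?_)
    · have key : ∀ (P : GrMod 𝒜) (p : P.carrier) (s t : Finset ℤ), s ⊆ t →
          p = ∑ i ∈ s, P.proj i p → p = ∑ i ∈ t, P.proj i p := by
        intro P p s t hst hp
        refine hp.trans (Finset.sum_subset hst fun i _ hi => ?_)
        have := P.proj_sum s (fun i => P.proj i p) (fun i => P.proj_mem i p) i
        rwa [← hp, if_neg hi] at this
      obtain ⟨s, hs⟩ := M.exists_sum m.1
      obtain ⟨t, ht⟩ := N.exists_sum m.2
      refine ⟨s ∪ t, fun i => (M.proj i m.1, N.proj i m.2),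
        fun i => ⟨M.proj_mem i m.1, N.proj_mem i m.2⟩, Prod.ext ?_ ?_⟩
      · rw [Prod.fst_sum]
        exact key M _ _ _ Finset.subset_union_left hs
      · rw [Prod.snd_sum]
        exact key N _ _ _ Finset.subset_union_right ht
    · refine Prod.ext ?_ ?_
      · exact M.eq_zero_of_sum s (fun i => (x i).1) (fun i => (hx i).1)
          (by rw [← Prod.fst_sum, h]; rfl) i hi
      · exact N.eq_zero_of_sum s (fun i => (x i).2) (fun i => (hx i).2)
          (by rw [← Prod.snd_sum, h]; rfl) i hi
  smul_mem := fun ha hm => ⟨M.smul_mem ha hm.1, N.smul_mem ha hm.2⟩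

/-- The binary bicone on the direct sum. -/
def prodBicone (M N : GrMod 𝒜) : BinaryBicone M N where
  pt := prod M N
  fst := mkHom (LinearMap.fst A M.carrier N.carrier) fun _ _ h => h.1
  snd := mkHom (LinearMap.snd A M.carrier N.carrier) fun _ _ h => h.2
  inl := mkHom (LinearMap.inl A M.carrier N.carrier) fun i _ h => ⟨h, (N.deg i).zero_mem⟩
  inr := mkHom (LinearMap.inr A M.carrier N.carrier) fun i _ h => ⟨(M.deg i).zero_mem, h⟩
  inl_fst := rfl
  inl_snd := rfl
  inr_fst := rfl
  inr_snd := rfl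

instance : HasBinaryBiproducts (GrMod 𝒜) where
  has_binary_biproduct M N := HasBinaryBiproduct.mk ⟨prodBicone M N,
    isBinaryBilimitOfTotal _ (hom_ext fun m =>
      Prod.ext (add_zero m.1) (zero_add m.2))⟩

instance : HasFiniteProducts (GrMod 𝒜) :=
  hasFiniteProducts_of_has_binary_and_terminal

theorem injective_of_mono {M N : GrMod 𝒜} (f : M ⟶ N) [Mono f] :
    Function.Injective (lin f) := by
  rw [injective_iff_map_eq_zero]
  intro m hm
  have h : kerι f = 0 := (cancel_mono f).1 (by rw [kerι_comp, zero_comp])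
  exact congrArg (fun g => lin g (⟨m, hm⟩ : LinearMap.ker (lin f))) h

theorem surjective_of_epi {M N : GrMod 𝒜} (f : M ⟶ N) [Epi f] :
    Function.Surjective (lin f) := by
  intro n
  have h : cokerπ f = 0 := (cancel_epi f).1 (by rw [comp_cokerπ, comp_zero])
  exact (Submodule.Quotient.mk_eq_zero _).1 (congrArg (fun g => lin g n) h)

/-- Preimages of homogeneous elements under injective morphisms are homogeneous. -/
theorem mem_of_injective {M N : GrMod 𝒜} (f : M ⟶ N) (hf : Function.Injective (lin f)) {i : ℤ}
    {m : M.carrier} (h : lin f m ∈ N.deg i) : m ∈ M.deg i := by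
  have : M.proj i m = m := hf (by rw [← proj_lin, N.proj_of_mem h])
  rw [← this]
  exact M.proj_mem i m

instance : IsNormalMonoCategory (GrMod 𝒜) where
  normalMonoOfMono {M N} f _ := by
    have hf := injective_of_mono f
    refine ⟨⟨cokerObj f, cokerπ f, comp_cokerπ f, ?_⟩⟩
    have key : ∀ {W : GrMod 𝒜} (g : W ⟶ N), g ≫ cokerπ f = 0 → ∃ l : W ⟶ M, l ≫ f = g := by
      intro W g hg
      have hr : ∀ w, lin g w ∈ LinearMap.range (lin f) := fun w =>
        (Submodule.Quotient.mk_eq_zero _).1 (congrArg (fun h => lin h w) hg)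
      let e := LinearEquiv.ofInjective (lin f) hf
      have he : ∀ w, lin f (e.symm ⟨lin g w, hr w⟩) = lin g w := fun w =>
        congrArg Subtype.val (e.apply_symm_apply ⟨lin g w, hr w⟩)
      refine ⟨mkHom (e.symm.toLinearMap.comp (LinearMap.codRestrict _ (lin g) hr))
        (fun i w hw => mem_of_injective f hf ?_), hom_ext he⟩
      exact (he w).symm ▸ lin_mem g hw
    choose l hl using @key
    exact KernelFork.IsLimit.ofι _ _ (fun g hg => l g hg) (fun g hg => hl g hg)
      (fun g hg m hm => (cancel_mono f).1 (by rw [hm, hl]))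

instance : IsNormalEpiCategory (GrMod 𝒜) where
  normalEpiOfEpi {M N} f _ := by
    have hf := surjective_of_epi f
    refine ⟨⟨kerObj f, kerι f, kerι_comp f, ?_⟩⟩
    have key : ∀ {W : GrMod 𝒜} (g : M ⟶ W), kerι f ≫ g = 0 → ∃ l : N ⟶ W, f ≫ l = g := by
      intro W g hg
      have hk : LinearMap.ker (lin f) ≤ LinearMap.ker (lin g) := fun m hm =>
        LinearMap.mem_ker.2
          (congrArg (fun h => lin h (⟨m, hm⟩ : LinearMap.ker (lin f))) hg)
      let e := (lin f).quotKerEquivOfSurjective hf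
      have he : ∀ m, e.symm (lin f m) = (LinearMap.ker (lin f)).mkQ m := fun m =>
        e.symm_apply_eq.2 rfl
      have hl : ∀ m, (((LinearMap.ker (lin f)).liftQ (lin g) hk).comp e.symm.toLinearMap)
          (lin f m) = lin g m := by
        intro m
        rw [LinearMap.comp_apply, LinearEquiv.coe_coe, he]
        rfl
      refine ⟨mkHom (((LinearMap.ker (lin f)).liftQ (lin g) hk).comp e.symm.toLinearMap)
        (fun i n hn => ?_), hom_ext hl⟩
      obtain ⟨m, rfl⟩ := hf n
      rw [← N.proj_of_mem hn, proj_lin, hl]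
      exact lin_mem g (M.proj_mem i m)
    choose l hl using @key
    exact CokernelCofork.IsColimit.ofπ _ _ (fun g hg => l g hg) (fun g hg => hl g hg)
      (fun g hg m hm => (cancel_epi f).1 (by rw [hm, hl]))

instance : Abelian (GrMod 𝒜) where

end

end GrMod

/-! ### Graded algebras, the regular module and its top -/

/-- A `ℤ`-graded algebra is non-negatively graded if `A_i = 0` for `i < 0`. -/
class IsNonnegGraded {K : Type u} {A : Type v} [Field K] [Ring A] [Algebra K A]
    (𝒜 : ℤ → Submodule K A) : Prop where
  eq_bot : ∀ i < 0, 𝒜 i = ⊥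

section

variable {K : Type u} {A : Type v} [Field K] [Ring A] [Algebra K A]

/-- The opposite grading on the opposite algebra: `(A^op)_i = A_i`. -/
def opGrading (𝒜 : ℤ → Submodule K A) (i : ℤ) : Submodule K Aᵐᵒᵖ :=
  (𝒜 i).map (MulOpposite.opLinearEquiv K).toLinearMap

theorem mem_opGrading {𝒜 : ℤ → Submodule K A} {i : ℤ} {x : Aᵐᵒᵖ} :
    x ∈ opGrading 𝒜 i ↔ x.unop ∈ 𝒜 i :=
  ⟨by rintro ⟨a, ha, rfl⟩; exact ha, fun h => ⟨_, h, rfl⟩⟩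

variable (𝒜 : ℤ → Submodule K A) [GradedAlgebra 𝒜]

/-- `A` as a graded left module over itself. -/
def GrMod.regular : GrMod 𝒜 where
  carrier := A
  deg i := (𝒜 i).toAddSubgroup
  isInternal := DirectSum.Decomposition.isInternal 𝒜
  smul_mem := fun ha hm => SetLike.mul_mem_graded ha hm

instance : SetLike.GradedMonoid (opGrading 𝒜) where
  one_mem := mem_opGrading.2 (SetLike.one_mem_graded 𝒜)
  mul_mem := fun i j x y hx hy => mem_opGrading.2 (by
    rw [add_comm]
    exact SetLike.mul_mem_graded (mem_opGrading.1 hy) (mem_opGrading.1 hx))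

theorem exists_homogeneous_sum (m : A) :
    ∃ (s : Finset ℤ) (x : ℤ → A), (∀ i, x i ∈ 𝒜 i) ∧ m = ∑ i ∈ s, x i := by
  classical
  exact ⟨_, fun i => DirectSum.decompose 𝒜 m i, fun i => (DirectSum.decompose 𝒜 m i).2,
    (DirectSum.sum_support_decompose 𝒜 m).symm⟩

theorem homogeneous_eq_zero_of_sum (s : Finset ℤ) (x : ℤ → A) (hx : ∀ i, x i ∈ 𝒜 i)
    (h : ∑ i ∈ s, x i = 0) : ∀ i ∈ s, x i = 0 :=
  (GrMod.regular 𝒜).eq_zero_of_sum s x hx h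

theorem opGrading_isInternal : DirectSum.IsInternal (opGrading 𝒜) := by
  refine isInternal_of_sums _ (fun m => ?_) (fun s x hx h i hi => ?_)
  · obtain ⟨s, x, hx, hs⟩ := exists_homogeneous_sum 𝒜 m.unop
    refine ⟨s, fun i => MulOpposite.op (x i), fun i => mem_opGrading.2 (hx i), ?_⟩
    rw [← MulOpposite.op_unop m, hs]
    exact map_sum (MulOpposite.opAddEquiv (α := A)) x s
  · apply MulOpposite.unop_injective
    refine homogeneous_eq_zero_of_sum 𝒜 s (fun i => (x i).unop)
      (fun i => mem_opGrading.1 (hx i)) ?_ i hi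
    exact (map_sum (MulOpposite.opAddEquiv (α := A)).symm x s).symm.trans
      (congrArg MulOpposite.unop h)

/-- The opposite algebra of a graded algebra is a graded algebra. -/
instance : GradedAlgebra (opGrading 𝒜) where
  toDecomposition := (opGrading_isInternal 𝒜).chooseDecomposition

instance [IsNonnegGraded 𝒜] : IsNonnegGraded (opGrading 𝒜) where
  eq_bot i hi := by
    rw [opGrading, IsNonnegGraded.eq_bot (𝒜 := 𝒜) i hi, Submodule.map_bot]

/-- Homogeneous elements of positive degree of a finite dimensional non-negatively graded algebra
lie in the Jacobson radical. -/
theorem mem_jacobson_of_pos [Module.Finite K A] [IsNonnegGraded 𝒜] {i : ℤ} (hi : 0 < i) {x : A}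
    (hx : x ∈ 𝒜 i) : x ∈ Ring.jacobson A := by
  classical
  let F : ℤ → Submodule K A := fun n => ⨆ i : {i : ℤ // n ≤ i}, 𝒜 i
  have hF : ∀ m n, F m * F n ≤ F (m + n) := by
    intro m n
    simp only [F, Submodule.iSup_mul, Submodule.mul_iSup]
    refine iSup_le fun j => iSup_le fun k => Submodule.mul_le.2 fun a ha b hb => ?_
    exact (le_iSup (fun i : {i : ℤ // m + n ≤ i} => 𝒜 i) ⟨_, by have := j.2; have := k.2; omega⟩)
      (SetLike.mul_mem_graded ha hb)
  have hF0 : F 0 = ⊤ := by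
    rw [eq_top_iff, ← (DirectSum.Decomposition.isInternal 𝒜).submodule_iSup_eq_top]
    refine iSup_le fun j => ?_
    rcases lt_or_ge j 0 with h | h
    · rw [IsNonnegGraded.eq_bot (𝒜 := 𝒜) j h]
      exact bot_le
    · exact le_iSup (fun i : {i : ℤ // 0 ≤ i} => 𝒜 i) ⟨j, h⟩
  obtain ⟨N, hN⟩ : ∃ N : ℕ, F N = ⊥ := by
    have hfin := WellFoundedGT.finite_ne_bot_of_iSupIndep
      (DirectSum.Decomposition.isInternal 𝒜).submodule_iSupIndep
    obtain ⟨b, hb⟩ := hfin.bddAbove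
    refine ⟨(b + 1).toNat, eq_bot_iff.2 (iSup_le fun j => ?_)⟩
    by_contra hne
    have h1 : (j : ℤ) ≤ b := hb (show 𝒜 j ≠ ⊥ from fun h => hne (h ▸ le_rfl))
    have h2 := j.2
    omega
  rw [← Ideal.jacobson_bot, Ideal.mem_jacobson_iff]
  intro y
  have hyx : y * x ∈ F 1 := by
    have h1 : x ∈ F 1 := (le_iSup (fun i : {i : ℤ // 1 ≤ i} => 𝒜 i) ⟨i, hi⟩) hx
    have h2 : y ∈ F 0 := hF0 ▸ Submodule.mem_top
    simpa using hF 0 1 (Submodule.mul_mem_mul h2 h1)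
  have hpow : ∀ n : ℕ, (y * x) ^ n ∈ F n := by
    intro n
    induction n with
    | zero => simpa using (hF0 ▸ Submodule.mem_top : (1 : A) ∈ F 0)
    | succ n ih =>
      rw [pow_succ]
      simpa using hF n 1 (Submodule.mul_mem_mul ih hyx)
  have hnil : IsNilpotent (y * x) := ⟨N, by simpa [hN] using hpow N⟩
  obtain ⟨w, hw⟩ := hnil.isUnit_one_add
  refine ⟨((w⁻¹ : Aˣ) : A), ?_⟩
  have h3 : ((w⁻¹ : Aˣ) : A) * (1 + y * x) = 1 := by rw [← hw, Units.inv_mul]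
  rw [mul_add, mul_one, ← mul_assoc] at h3
  rw [Ideal.mem_bot, sub_eq_zero, add_comm]
  exact h3

/-- The Jacobson radical of a finite dimensional non-negatively graded algebra is homogeneous. -/
theorem GrMod.isHomog_jacobson [Module.Finite K A] [IsNonnegGraded 𝒜] :
    (GrMod.regular 𝒜).IsHomog (Ring.jacobson A) := by
  classical
  intro m hm i
  obtain ⟨s, x, hx, hs⟩ := exists_homogeneous_sum 𝒜 m
  have hne : ∀ j, j ≠ 0 → x j ∈ Ring.jacobson A := by
    intro j hj
    have hmem := hx j
    rcases lt_or_gt_of_ne hj with h | h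
    · rw [IsNonnegGraded.eq_bot (𝒜 := 𝒜) j h] at hmem
      rw [(Submodule.mem_bot K).1 hmem]
      exact Submodule.zero_mem _
    · exact mem_jacobson_of_pos 𝒜 h hmem
  have hall : ∀ j ∈ s, x j ∈ Ring.jacobson A := by
    intro j hj
    by_cases h : j = 0
    · subst h
      have h1 : x 0 = (∑ i ∈ s, x i) - ∑ i ∈ s.erase 0, x i :=
        eq_sub_of_add_eq (Finset.add_sum_erase s x hj)
      rw [h1]
      exact (Ring.jacobson A).sub_mem (hs ▸ hm)
        (Submodule.sum_mem _ fun j hj => hne j (Finset.ne_of_mem_erase hj))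
    · exact hne j h
  have h2 : (GrMod.regular 𝒜).proj i m = if i ∈ s then x i else 0 :=
    (congrArg _ hs).trans ((GrMod.regular 𝒜).proj_sum s x hx i)
  rw [h2]
  split_ifs with h
  · exact hall i h
  · exact (Ring.jacobson A).zero_mem

/-- The graded left module `A / J_A`, where `J_A` is the Jacobson radical of `A`. -/
def GrMod.top [Module.Finite K A] [IsNonnegGraded 𝒜] : GrMod 𝒜 :=
  (GrMod.regular 𝒜).quot (Ring.jacobson A) (GrMod.isHomog_jacobson 𝒜)

/-! ### Homological invariants -/

variable {𝒜} in
/-- `Ext^n(M, N) ≠ 0`, the extension group being that of the abelian category `Mod^ℤ A`,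
i.e. the degree `0` part of `Ext^n_A(M, N)`. -/
def GrMod.ExtNeZero (n : ℕ) (M N : GrMod 𝒜) : Prop :=
  letI := HasExt.standard (GrMod 𝒜)
  Nontrivial (Abelian.Ext M N n)

variable {𝒜} in
/-- `g(M) = sup {i ∈ ℤ | ∃ n ≥ 0, Ext^n_A((A / J_A)(i), M)_0 ≠ 0}`, as an extended real
number, for a graded left module `M`. -/
def GrMod.g [Module.Finite K A] [IsNonnegGraded 𝒜] (M : GrMod 𝒜) : EReal :=
  sSup {x | ∃ i : ℤ, x = ((i : ℝ) : EReal) ∧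
    ∃ n : ℕ, GrMod.ExtNeZero n ((GrMod.top 𝒜).shift i) M}

/-- `A_A`, the algebra `A` as a graded right module over itself; right `A`-modules
are left `A^op`-modules. -/
abbrev GrMod.regularRight : GrMod (opGrading 𝒜) := GrMod.regular (opGrading 𝒜)

/-- `g(A) = g(A_A)`, computed in graded right `A`-modules. -/
def gInvariant [Module.Finite K A] [IsNonnegGraded 𝒜] : EReal := (GrMod.regularRight 𝒜).g

/-- `g(A^op) = g(_A A)`, computed in graded left `A`-modules. -/
def gInvariantOp [Module.Finite K A] [IsNonnegGraded 𝒜] : EReal := (GrMod.regular 𝒜).g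

/-- A graded algebra is graded Iwanaga-Gorenstein if, for some `d`, both `A_A` and `_A A` have
graded injective dimension at most `d`. -/
def IsGradedIG : Prop :=
  ∃ d : ℕ, HasInjectiveDimensionLE (GrMod.regularRight 𝒜) d ∧
    HasInjectiveDimensionLE (GrMod.regular 𝒜) d

end

/-- `Λ` has finite (right) global dimension: there is a common bound for the projective dimensions
of all right `Λ`-modules. -/
def HasFiniteGlobalDimension (Λ : Type v) [Ring Λ] : Prop :=
  ∃ d : ℕ, ∀ M : ModuleCat.{v} Λᵐᵒᵖ, HasProjectiveDimensionLE M d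

end

/-! Let `B` be anti-isomorphic to `A`, and suppose `Ext^n((B/J_B)(i), B)_0 = 0` for all `n` and all
`i > 0`. The same vanishing for `A` follows by playing degrees against each other through the graded
vector space dual `D`, which exchanges the two sides.

For `j > 0` put `L = D(B(-j))`. The hypothesis says that no shift `(B/J_B)(i)` with `i > -j` has
extensions by `D L = B(-j)`. Dually, `L` has a resolution by free modules with generators in degrees
`≤ -j < 0`. Since `A` lives in degrees `≥ 0`, there are no nonzero maps from these modules to `A`,
so `Ext^n(L, A)_0 = 0` for every `n`. This is `extZero_dual_shift_regular`, resting on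
`span_eq_top_of_dual` (socle of the dual versus generators) and `extZero_of_dual` (syzygies).

Now let `S` be finitely generated in negative degrees. Cover `D S` by a free module `F` with
generators in positive degrees and dualise: `S` embeds into `D F`, which is again in negative
degrees and has no extensions by `A`. So `Ext^n(S, A)_0` embeds into `Ext^(n+1)` of the cokernel, a
module of the same kind. Finite injective dimension of `A` ends the iteration (`extZero_regular`).
Finally, `(A/J_A)(i)` sits in degree `-i`, so it is such an `S` when `i > 0`. -/

noncomputable section

/-! ### Vanishing of extension groups -/

namespace ExtVanishing

open Abelian

universe w v' u'

variable {C : Type u'} [Category.{v'} C] [Abelian C] [HasExt.{w} C] {S : ShortComplex C}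
  (hS : S.ShortExact)

include hS

theorem covariant_middle {X : C} {n : ℕ} (h₁ : Subsingleton (Ext X S.X₁ n))
    (h₃ : Subsingleton (Ext X S.X₃ n)) : Subsingleton (Ext X S.X₂ n) := by
  refine subsingleton_of_forall_eq 0 fun x => ?_
  obtain ⟨y, rfl⟩ := Ext.covariant_sequence_exact₂ X hS x (Subsingleton.elim _ _)
  rw [Subsingleton.elim y 0, Ext.zero_comp]

theorem covariant_right {X : C} {n : ℕ} (h₂ : Subsingleton (Ext X S.X₂ n))
    (h₁ : Subsingleton (Ext X S.X₁ (n + 1))) : Subsingleton (Ext X S.X₃ n) := by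
  refine subsingleton_of_forall_eq 0 fun x => ?_
  obtain ⟨y, rfl⟩ := Ext.covariant_sequence_exact₃ X hS x rfl (Subsingleton.elim _ _)
  rw [Subsingleton.elim y 0, Ext.zero_comp]

theorem contravariant_middle {Y : C} {n : ℕ} (h₁ : Subsingleton (Ext S.X₁ Y n))
    (h₃ : Subsingleton (Ext S.X₃ Y n)) : Subsingleton (Ext S.X₂ Y n) := by
  refine subsingleton_of_forall_eq 0 fun x => ?_
  obtain ⟨y, rfl⟩ := Ext.contravariant_sequence_exact₂ hS Y x (Subsingleton.elim _ _)
  rw [Subsingleton.elim y 0, Ext.comp_zero]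

/-- The dimension shift of the whole proof: it passes to the syzygy of a free cover, and it pushes
the vanishing problem from a submodule to the cokernel one degree up. -/
theorem contravariant_left {Y : C} {n : ℕ} (h₂ : Subsingleton (Ext S.X₂ Y n))
    (h₃ : Subsingleton (Ext S.X₃ Y (n + 1))) : Subsingleton (Ext S.X₁ Y n) := by
  refine subsingleton_of_forall_eq 0 fun x => ?_
  obtain ⟨y, rfl⟩ := Ext.contravariant_sequence_exact₁ hS Y x (add_comm 1 n)
    (Subsingleton.elim _ _)
  rw [Subsingleton.elim y 0, Ext.comp_zero]

theorem contravariant_right {Y : C} {n : ℕ} (h₁ : Subsingleton (Ext S.X₁ Y n))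
    (h₂ : Subsingleton (Ext S.X₂ Y (n + 1))) : Subsingleton (Ext S.X₃ Y (n + 1)) := by
  refine subsingleton_of_forall_eq 0 fun x => ?_
  obtain ⟨y, rfl⟩ := Ext.contravariant_sequence_exact₃ hS Y x (Subsingleton.elim _ _)
    (add_comm 1 n)
  rw [Subsingleton.elim y 0, Ext.comp_zero]

/-- If `Ext¹(S.X₃, Y) = 0` then every morphism `S.X₁ ⟶ Y` extends to `S.X₂`. -/
theorem exists_extension {Y : C} (h₃ : Subsingleton (Ext S.X₃ Y 1)) (f : S.X₁ ⟶ Y) :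
    ∃ g : S.X₂ ⟶ Y, S.f ≫ g = f := by
  obtain ⟨y, hy⟩ := Ext.contravariant_sequence_exact₁ hS Y (Ext.mk₀ f) (add_comm 1 0)
    (Subsingleton.elim _ _)
  obtain ⟨g, rfl⟩ := (Ext.mk₀_bijective _ _).2 y
  exact ⟨g, (Ext.mk₀_bijective _ _).1 (by rw [← hy, Ext.mk₀_comp_mk₀])⟩

/-- If `Ext¹(S.X₂, Y) = 0` and every morphism `S.X₁ ⟶ Y` extends to `S.X₂` then
`Ext¹(S.X₃, Y) = 0`. -/
theorem ext_one_of_extension {Y : C} (h₂ : Subsingleton (Ext S.X₂ Y 1))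
    (h : ∀ f : S.X₁ ⟶ Y, ∃ g : S.X₂ ⟶ Y, S.f ≫ g = f) : Subsingleton (Ext S.X₃ Y 1) := by
  refine subsingleton_of_forall_eq 0 fun x => ?_
  obtain ⟨y, rfl⟩ := Ext.contravariant_sequence_exact₃ hS Y x (Subsingleton.elim _ _)
    (add_comm 1 0)
  obtain ⟨f, rfl⟩ := (Ext.mk₀_bijective _ _).2 y
  obtain ⟨g, rfl⟩ := h f
  rw [← Ext.mk₀_comp_mk₀, ← Ext.comp_assoc (a₁₂ := 1) (a₂₃ := 0) _ _ _ rfl rfl rfl,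
    hS.extClass_comp, Ext.zero_comp]

omit hS

theorem of_iso_left {X X' Y : C} (e : X ≅ X') {n : ℕ} (h : Subsingleton (Ext X Y n)) :
    Subsingleton (Ext X' Y n) := by
  refine subsingleton_of_forall_eq 0 fun x => ?_
  rw [← Ext.mk₀_id_comp x, ← e.inv_hom_id, ← Ext.mk₀_comp_mk₀_assoc,
    Subsingleton.elim ((Ext.mk₀ e.hom).comp x _) 0, Ext.comp_zero]

theorem of_iso_right {X Y Y' : C} (e : Y ≅ Y') {n : ℕ} (h : Subsingleton (Ext X Y n)) :
    Subsingleton (Ext X Y' n) := by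
  refine subsingleton_of_forall_eq 0 fun x => ?_
  rw [← Ext.comp_mk₀_id x, ← e.inv_hom_id, ← Ext.mk₀_comp_mk₀,
    ← Ext.comp_assoc (a₁₂ := n) (a₂₃ := 0) _ _ _ rfl rfl rfl,
    Subsingleton.elim (x.comp (Ext.mk₀ e.inv) _) 0, Ext.zero_comp]

theorem of_isZero_left {X Y : C} (h : IsZero X) (n : ℕ) : Subsingleton (Ext X Y n) := by
  refine subsingleton_of_forall_eq 0 fun x => ?_
  rw [← Ext.mk₀_id_comp x, h.eq_of_src (𝟙 X) 0, Ext.mk₀_zero, Ext.zero_comp]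

theorem of_isZero_right {X Y : C} (h : IsZero Y) (n : ℕ) : Subsingleton (Ext X Y n) := by
  refine subsingleton_of_forall_eq 0 fun x => ?_
  rw [← Ext.comp_mk₀_id x, h.eq_of_src (𝟙 Y) 0, Ext.mk₀_zero, Ext.comp_zero]

theorem zero_iff {X Y : C} : Subsingleton (Ext X Y 0) ↔ ∀ f : X ⟶ Y, f = 0 := by
  rw [Ext.homEquiv₀.subsingleton_congr]
  exact ⟨fun h f => Subsingleton.elim _ _, fun h => subsingleton_of_forall_eq 0 h⟩

end ExtVanishing

namespace GrMod

open Abelian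

section

variable {K : Type u} {A : Type v} [Field K] [Ring A] [Algebra K A] {𝒜 : ℤ → Submodule K A}

/-- The same choice as inside `ExtNeZero`, so vanishing is its negation without any comparison of
different models of Ext. -/
instance hasExtStandard : HasExt.{v + 1} (GrMod 𝒜) := HasExt.standard (GrMod 𝒜)

/-- The extension group `Ext^n(M, N)` in `Mod^ℤ A` vanishes. -/
abbrev ExtZero (n : ℕ) (M N : GrMod 𝒜) : Prop := Subsingleton (Ext.{v + 1} M N n)

theorem not_extNeZero_iff {n : ℕ} {M N : GrMod 𝒜} : ¬ ExtNeZero n M N ↔ ExtZero n M N :=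
  not_nontrivial_iff_subsingleton

/-! ### Exactness in the category of graded modules -/

theorem mono_of_injective {M N : GrMod 𝒜} (f : M ⟶ N) (hf : Function.Injective (lin f)) :
    Mono f :=
  Preadditive.mono_of_cancel_zero f fun g h => hom_ext fun m =>
    hf (by rw [lin_zero, map_zero]; exact congrArg (fun k => lin k m) h)

theorem epi_of_surjective {M N : GrMod 𝒜} (f : M ⟶ N) (hf : Function.Surjective (lin f)) :
    Epi f :=
  Preadditive.epi_of_cancel_zero f fun g h => hom_ext fun m => by
    obtain ⟨m, rfl⟩ := hf m
    exact congrArg (fun k => lin k m) h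

/-- Linear isomorphisms compatible with the gradings are isomorphisms. -/
theorem nonempty_iso_of_bijective {M N : GrMod 𝒜} (f : M ⟶ N)
    (hf : Function.Bijective (lin f)) : Nonempty (M ≅ N) := by
  have := mono_of_injective f hf.1
  have := epi_of_surjective f hf.2
  have := isIso_of_mono_of_epi f
  exact ⟨asIso f⟩

theorem isZero_of_subsingleton {M : GrMod 𝒜} (h : Subsingleton M.carrier) : IsZero M :=
  (IsZero.iff_id_eq_zero M).2 (hom_ext fun _ => Subsingleton.elim _ _)

theorem lin_comp_eq_zero {L M N : GrMod 𝒜} {f : L ⟶ M} {g : M ⟶ N} (w : f ≫ g = 0)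
    (l : L.carrier) : lin g (lin f l) = 0 :=
  congrArg (fun h => lin h l) w

/-- By elementwise exactness `f` factors as an isomorphism `k` onto `kerObj g` followed by the
inclusion, so `f` is itself a kernel of `g`. -/
theorem shortExact_of_lin {L M N : GrMod 𝒜} (f : L ⟶ M) (g : M ⟶ N) (w : f ≫ g = 0)
    (hf : Function.Injective (lin f)) (hg : Function.Surjective (lin g))
    (hfg : ∀ m, lin g m = 0 → ∃ l, lin f l = m) : (ShortComplex.mk f g w).ShortExact := by
  have := mono_of_injective f hf
  have := epi_of_surjective g hg
  let k : L ⟶ kerObj g := mkHom (LinearMap.codRestrict _ (lin f) fun l =>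
    LinearMap.mem_ker.2 (congrArg (fun h => lin h l) w)) fun _ _ h => lin_mem f h
  have hk : k ≫ kerι g = f := rfl
  have := mono_of_injective k fun a b h => hf (congrArg Subtype.val h)
  have := epi_of_surjective k fun m => by
    obtain ⟨l, hl⟩ := hfg m.1 m.2
    exact ⟨l, Subtype.ext hl⟩
  have := isIso_of_mono_of_epi k
  have hkf : inv k ≫ f = kerι g := (IsIso.inv_comp_eq k).2 hk.symm
  have hlift : ∀ {W : GrMod 𝒜} (x : W ⟶ M) (hx : x ≫ g = 0),
      ((kerIsLimit g).lift (KernelFork.ofι x hx) ≫ inv k) ≫ f = x := fun x hx => by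
    rw [Category.assoc, hkf]
    exact (kerIsLimit g).fac (KernelFork.ofι x hx) WalkingParallelPair.zero
  exact
    { exact := ShortComplex.exact_of_f_is_kernel _ (KernelFork.IsLimit.ofι _ _
        (fun x hx => (kerIsLimit g).lift (KernelFork.ofι x hx) ≫ inv k) hlift
        (fun x hx m hm => (cancel_mono f).1 (hm.trans (hlift x hx).symm))) }

/-- The short exact sequence `0 → ker p → M → N → 0` of an epimorphism. -/
theorem shortExact_kerι {M N : GrMod 𝒜} (p : M ⟶ N) (hp : Function.Surjective (lin p)) :
    (ShortComplex.mk (kerι p) p (kerι_comp p)).ShortExact :=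
  shortExact_of_lin _ _ _ Subtype.val_injective hp fun m hm => ⟨⟨m, hm⟩, rfl⟩

/-- The short exact sequence `0 → M → N → coker f → 0` of a monomorphism. -/
theorem shortExact_cokerπ {M N : GrMod 𝒜} (f : M ⟶ N) (hf : Function.Injective (lin f)) :
    (ShortComplex.mk f (cokerπ f) (comp_cokerπ f)).ShortExact :=
  shortExact_of_lin _ _ _ hf (Submodule.mkQ_surjective _)
    fun _ hm => (Submodule.Quotient.mk_eq_zero _).1 hm

/-- The split short exact sequence of a direct sum. -/
theorem shortExact_prod (M N : GrMod 𝒜) :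
    (ShortComplex.mk (prodBicone M N).inl (prodBicone M N).snd
      (prodBicone M N).inl_snd).ShortExact :=
  shortExact_of_lin _ _ _ (LinearMap.inl_injective (R := A) (M := M.carrier) (M₂ := N.carrier))
    (LinearMap.snd_surjective (R := A) (M := M.carrier) (M₂ := N.carrier))
    fun m hm => ⟨m.1, Prod.ext rfl hm.symm⟩

/-! ### The shift -/

/-- The shift of a morphism. -/
def shiftHom {M N : GrMod 𝒜} (f : M ⟶ N) (k : ℤ) : M.shift k ⟶ N.shift k :=
  mkHom (M := M.shift k) (N := N.shift k) (lin (M := M) (N := N) f)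
    fun i _ hm => lin_mem f (i := i + k) hm

/-- A morphism between shifted modules as a morphism between the modules. -/
def unshiftHom {M N : GrMod 𝒜} {k : ℤ} (f : M.shift k ⟶ N.shift k) : M ⟶ N :=
  mkHom (M := M) (N := N) (lin (M := M.shift k) (N := N.shift k) f) fun i m hm => by
    have h : m ∈ M.deg (i - k + k) := by rwa [sub_add_cancel]
    have h' : lin f m ∈ N.deg (i - k + k) := lin_mem f (i := i - k) h
    rwa [sub_add_cancel] at h'

theorem shortExact_shift {L M N : GrMod 𝒜} {f : L ⟶ M} {g : M ⟶ N} {w : f ≫ g = 0}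
    (hf : Function.Injective (lin f)) (hg : Function.Surjective (lin g))
    (hfg : ∀ m, lin g m = 0 → ∃ l, lin f l = m) (k : ℤ) :
    (ShortComplex.mk (shiftHom f k) (shiftHom g k)
      (hom_ext (M := L.shift k) fun l => lin_comp_eq_zero w (L := L) l)).ShortExact :=
  shortExact_of_lin _ _ _ hf hg hfg

/-- The identity map works, but the two degree functions agree only up to associativity and
commutativity in `ℤ`, hence an isomorphism rather than a definitional equality. -/
theorem nonempty_iso_shift_add (M : GrMod 𝒜) (j k : ℤ) :
    Nonempty ((M.shift j).shift k ≅ M.shift (j + k)) := by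
  have h (i : ℤ) : ((M.shift j).shift k).deg i = (M.shift (j + k)).deg i :=
    congrArg M.deg (by ring)
  exact nonempty_iso_of_bijective (M := (M.shift j).shift k) (N := M.shift (j + k))
    (mkHom LinearMap.id fun i m hm => (h i) ▸ hm) Function.bijective_id

theorem nonempty_iso_shift_zero (M : GrMod 𝒜) : Nonempty (M.shift 0 ≅ M) := by
  have h (i : ℤ) : (M.shift 0).deg i = M.deg i := congrArg M.deg (by ring)
  exact nonempty_iso_of_bijective (M := M.shift 0) (N := M)
    (mkHom LinearMap.id fun i m hm => (h i) ▸ hm) Function.bijective_id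

/-! ### Scalars from the base field -/

instance moduleBase (M : GrMod 𝒜) : Module K M.carrier :=
  Module.compHom M.carrier (algebraMap K A)

theorem base_smul_def (M : GrMod 𝒜) (c : K) (m : M.carrier) : c • m = algebraMap K A c • m := rfl

instance isScalarTowerBase (M : GrMod 𝒜) : IsScalarTower K A M.carrier where
  smul_assoc c a m := by rw [base_smul_def, Algebra.smul_def, mul_smul]

variable [GradedAlgebra 𝒜]

theorem base_smul_mem (M : GrMod 𝒜) (c : K) {i : ℤ} {m : M.carrier} (hm : m ∈ M.deg i) :
    c • m ∈ M.deg i := by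
  have := M.smul_mem (SetLike.algebraMap_mem_graded 𝒜 c) hm
  rwa [zero_add] at this

/-- The projection to a homogeneous component as a linear map over the base field. -/
def projLin (M : GrMod 𝒜) (i : ℤ) : M.carrier →ₗ[K] M.carrier where
  toFun := M.proj i
  map_add' x y := by simp [proj]
  map_smul' c x := by
    -- Scalars are central of degree `0`, so multiplication by `c` is a morphism and commutes with
    -- homogeneous components.
    let f : M ⟶ M := mkHom
      { toFun := fun m => c • m
        map_add' := fun x y => smul_add c x y
        map_smul' := fun a m => by
          change algebraMap K A c • a • m = a • algebraMap K A c • m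
          rw [← mul_smul, ← mul_smul, Algebra.commutes] }
      fun i m hm => M.base_smul_mem c hm
    exact proj_lin f i x

@[simp] theorem projLin_apply (M : GrMod 𝒜) (i : ℤ) (m : M.carrier) :
    M.projLin i m = M.proj i m := rfl

omit [GradedAlgebra 𝒜] in
theorem proj_of_mem_ne (M : GrMod 𝒜) {i j : ℤ} {m : M.carrier} (h : m ∈ M.deg i) (hij : i ≠ j) :
    M.proj j m = 0 :=
  DirectSum.decompose_of_mem_ne _ h hij

/-! ### Finitely generated graded free modules -/

/-- The morphism from a shifted regular module determined by a homogeneous element. -/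
def ofHomogeneous (M : GrMod 𝒜) {k : ℤ} {x : M.carrier} (hx : x ∈ M.deg k) :
    (regular 𝒜).shift (-k) ⟶ M :=
  mkHom (M := (regular 𝒜).shift (-k)) (LinearMap.toSpanSingleton A M.carrier x)
    fun i a ha => by
      have := M.smul_mem (i := i + -k) (a := a) ha hx
      rwa [neg_add_cancel_right] at this

/-- The generator of a shifted regular module. -/
def shiftOne (k : ℤ) : ((regular 𝒜).shift (-k)).carrier := (1 : A)

theorem shiftOne_mem (k : ℤ) : shiftOne k ∈ ((regular 𝒜).shift (-k)).deg k := by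
  change (1 : A) ∈ 𝒜 (k + -k)
  rw [add_neg_cancel]
  exact SetLike.one_mem_graded 𝒜

theorem lin_ofHomogeneous (M : GrMod 𝒜) {k : ℤ} {x : M.carrier} (hx : x ∈ M.deg k) :
    lin (M.ofHomogeneous hx) (shiftOne k) = x := one_smul A x

theorem shift_regular_hom_ext {k : ℤ} {M : GrMod 𝒜} {f g : (regular 𝒜).shift (-k) ⟶ M}
    (h : lin f (shiftOne k) = lin g (shiftOne k)) : f = g :=
  hom_ext fun a => by
    have ha : a = (show A from a) • shiftOne (𝒜 := 𝒜) k := (mul_one (show A from a)).symm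
    rw [ha, map_smul, map_smul, h]

theorem hom_shift_regular_eq_zero {k : ℤ} {M : GrMod 𝒜} (h : M.deg k = ⊥)
    (f : (regular 𝒜).shift (-k) ⟶ M) : f = 0 := by
  have h1 := lin_mem f (shiftOne_mem k)
  rw [h, AddSubgroup.mem_bot] at h1
  exact shift_regular_hom_ext (by rw [h1, lin_zero])

/-- A lift of the image of the generator need not be homogeneous; its degree `k` component is, and
it is still a lift. -/
theorem projective_shift_regular (k : ℤ) : Projective ((regular 𝒜).shift (-k)) where
  factors {N M} f e he := by
    obtain ⟨x, hx⟩ := surjective_of_epi e (lin f (shiftOne k))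
    refine ⟨ofHomogeneous N (N.proj_mem k x), shift_regular_hom_ext ?_⟩
    rw [lin_comp, lin_ofHomogeneous, ← proj_lin, hx, proj_of_mem]
    exact lin_mem f (shiftOne_mem k)

/-- Finitely generated graded free modules with generators of degrees in `T`. -/
inductive IsFreeOn (T : Set ℤ) : GrMod 𝒜 → Prop
  | zero : IsFreeOn T zero
  | cons {k : ℤ} {P : GrMod 𝒜} (hk : k ∈ T) (hP : IsFreeOn T P) :
      IsFreeOn T (prod ((regular 𝒜).shift (-k)) P)

theorem IsFreeOn.finite {T : Set ℤ} {P : GrMod 𝒜} (hP : IsFreeOn T P) :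
    Module.Finite A P.carrier := by
  induction hP with
  | zero => exact inferInstanceAs (Module.Finite A PUnit.{v + 1})
  | cons hk hP ih =>
    rename_i k P
    exact inferInstanceAs (Module.Finite A (A × P.carrier))

/-- A shift of a free module is free only up to isomorphism, so `IsFreeOn` does not apply to it
directly. The induction therefore shifts the split sequences. -/
theorem IsFreeOn.extZero_shift {T : Set ℤ} {P : GrMod 𝒜} (hP : IsFreeOn T P) (k : ℤ) (n : ℕ)
    (M : GrMod 𝒜) : ExtZero (n + 1) (P.shift k) M := by
  induction hP with
  | zero => exact ExtVanishing.of_isZero_left (isZero_of_subsingleton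
      (inferInstanceAs (Subsingleton PUnit.{v + 1}))) _
  | cons hj hP ih =>
    rename_i j P
    refine ExtVanishing.contravariant_middle (shortExact_shift
      (f := (prodBicone ((regular 𝒜).shift (-j)) P).inl)
      (g := (prodBicone ((regular 𝒜).shift (-j)) P).snd) (w := BinaryBicone.inl_snd _)
      (LinearMap.inl_injective (R := A) (M := A) (M₂ := P.carrier))
      (LinearMap.snd_surjective (R := A) (M := A) (M₂ := P.carrier))
      (fun m hm => ⟨m.1, Prod.ext rfl hm.symm⟩) k) ?_ ih
    obtain ⟨e⟩ := nonempty_iso_shift_add (regular 𝒜) (-j) k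
    refine ExtVanishing.of_iso_left e.symm ?_
    have := projective_shift_regular (𝒜 := 𝒜) (j - k)
    rw [show -j + k = -(j - k) by ring]
    exact Ext.subsingleton_of_projective _ _ _

theorem IsFreeOn.extZero_succ {T : Set ℤ} {P : GrMod 𝒜} (hP : IsFreeOn T P) (n : ℕ)
    (M : GrMod 𝒜) : ExtZero (n + 1) P M := by
  obtain ⟨e⟩ := nonempty_iso_shift_zero P
  exact ExtVanishing.of_iso_left e (hP.extZero_shift 0 n M)

/-- Projectivity settles positive cohomological degrees; in degree `0` the generators have nowhere
to go. -/
theorem IsFreeOn.extZero {T : Set ℤ} {P : GrMod 𝒜} (hP : IsFreeOn T P) {M : GrMod 𝒜}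
    (hM : ∀ k ∈ T, M.deg k = ⊥) (n : ℕ) : ExtZero n P M := by
  cases n with
  | succ n => exact hP.extZero_succ n M
  | zero =>
    induction hP with
    | zero => exact ExtVanishing.of_isZero_left (isZero_of_subsingleton
        (inferInstanceAs (Subsingleton PUnit.{v + 1}))) _
    | cons hk hP ih =>
      refine ExtVanishing.contravariant_middle (shortExact_prod _ _) ?_ ih
      exact ExtVanishing.zero_iff.2 (hom_shift_regular_eq_zero (hM _ hk))

/-- A finitely generated graded module generated in degrees from `T` is a quotient of a finitely
generated graded free module with generators of degrees in `T`. -/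
theorem exists_free_cover (T : Set ℤ) (L : GrMod 𝒜) [Module.Finite A L.carrier]
    (h : Submodule.span A {x | ∃ k ∈ T, x ∈ L.deg k} = ⊤) :
    ∃ P : GrMod 𝒜, IsFreeOn T P ∧ ∃ p : P ⟶ L, Function.Surjective (lin p) := by
  classical
  -- Finite generation lets the finitely many generators be chosen among the given homogeneous ones.
  obtain ⟨t, ht, hspan⟩ := (Submodule.fg_span_iff_fg_span_finset_subset _).1
    (h ▸ Module.Finite.fg_top : (Submodule.span A {x | ∃ k ∈ T, x ∈ L.deg k}).FG)
  have key : ∀ s : Finset L.carrier, (s : Set L.carrier) ⊆ {x | ∃ k ∈ T, x ∈ L.deg k} →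
      ∃ P : GrMod 𝒜, IsFreeOn T P ∧ ∃ p : P ⟶ L, ∀ x ∈ s, x ∈ LinearMap.range (lin p) := by
    intro s
    induction s using Finset.induction_on with
    | empty => exact fun _ => ⟨_, .zero, 0, by simp⟩
    | insert x s hx ih =>
      intro hs
      obtain ⟨k, hk, hxk⟩ := hs (Finset.mem_insert_self x s)
      obtain ⟨P, hP, p, hp⟩ := ih fun y hy => hs (Finset.mem_insert_of_mem hy)
      refine ⟨_, .cons hk hP, (prodBicone _ P).fst ≫ L.ofHomogeneous hxk
        + (prodBicone _ P).snd ≫ p, fun y hy => ?_⟩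
      rcases Finset.mem_insert.1 hy with rfl | hy
      · refine ⟨((1 : A), (0 : P.carrier)), ?_⟩
        change (1 : A) • y + lin p 0 = y
        rw [one_smul, map_zero, add_zero]
      · obtain ⟨q, hq⟩ := hp y hy
        refine ⟨((0 : A), q), ?_⟩
        change (0 : A) • x + lin p q = y
        rw [zero_smul, zero_add, hq]
  obtain ⟨P, hP, p, hp⟩ := key t ht
  refine ⟨P, hP, p, LinearMap.range_eq_top.1 (eq_top_iff.2 ?_)⟩
  rw [← h, hspan]
  exact Submodule.span_le.2 hp

omit [GradedAlgebra 𝒜] in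
theorem span_homogeneous (L : GrMod 𝒜) :
    Submodule.span A {x | ∃ k ∈ (Set.univ : Set ℤ), x ∈ L.deg k} = ⊤ := by
  refine eq_top_iff.2 fun x _ => ?_
  obtain ⟨s, hs⟩ := L.exists_sum x
  rw [hs]
  exact Submodule.sum_mem _ fun i _ => Submodule.subset_span ⟨i, trivial, L.proj_mem i x⟩

variable [Module.Finite K A]

omit [GradedAlgebra 𝒜] in
theorem finite_kerObj {M N : GrMod 𝒜} [Module.Finite A M.carrier] (f : M ⟶ N) :
    Module.Finite A (kerObj f).carrier := by
  have : IsNoetherianRing A := isNoetherian_of_tower K inferInstance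
  exact inferInstanceAs (Module.Finite A (LinearMap.ker (lin f)))

/-- The shift preserves vanishing of extension groups. -/
theorem extZero_shift (n : ℕ) (X Y : GrMod 𝒜) (hX : Module.Finite A X.carrier) (k : ℤ)
    (h : ExtZero n X Y) : ExtZero n (X.shift k) (Y.shift k) := by
  induction n generalizing X with
  | zero =>
    rw [ExtZero, ExtVanishing.zero_iff] at h ⊢
    intro f
    exact congrArg (shiftHom · k) (h (unshiftHom f))
  | succ n ih =>
    obtain ⟨P, hP, p, hp⟩ := exists_free_cover Set.univ X X.span_homogeneous
    have := hP.finite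
    have hS := shortExact_kerι p hp
    have hS' := shortExact_shift (w := kerι_comp p) Subtype.val_injective hp
      (fun m hm => ⟨⟨m, hm⟩, rfl⟩) k
    -- `Ext^1` is special: it is the cokernel of restricting morphisms from `P` to the kernel, so
    -- its vanishing is an extension property. Higher groups are Ext groups of the kernel one degree
    -- lower.
    cases n with
    | zero =>
      refine ExtVanishing.ext_one_of_extension hS' (hP.extZero_shift k 0 _) fun f => ?_
      obtain ⟨g, hg⟩ := ExtVanishing.exists_extension hS h (unshiftHom f)
      exact ⟨shiftHom g k, congrArg (shiftHom · k) hg⟩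
    | succ n =>
      refine ExtVanishing.contravariant_right hS' (ih _ (finite_kerObj p) ?_)
        (hP.extZero_shift k (n + 1) _)
      exact ExtVanishing.contravariant_left hS (hP.extZero_succ n Y) h

end

end GrMod

/-! ### Graded anti-isomorphisms -/

/-- A degree preserving anti-isomorphism of graded algebras. -/
structure GradedAntiEquiv {K : Type u} {A B : Type v} [Field K] [Ring A] [Algebra K A] [Ring B]
    [Algebra K B] (𝒜 : ℤ → Submodule K A) (ℬ : ℤ → Submodule K B) where
  toEquiv : B ≃ₗ[K] A
  map_one : toEquiv 1 = 1
  map_mul : ∀ x y, toEquiv (x * y) = toEquiv y * toEquiv x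
  mem_iff : ∀ i b, toEquiv b ∈ 𝒜 i ↔ b ∈ ℬ i

namespace GradedAntiEquiv

variable {K : Type u} {A B : Type v} [Field K] [Ring A] [Algebra K A] [Ring B] [Algebra K B]
  {𝒜 : ℤ → Submodule K A} {ℬ : ℤ → Submodule K B}

/-- The inverse anti-isomorphism. -/
def symm (σ : GradedAntiEquiv 𝒜 ℬ) : GradedAntiEquiv ℬ 𝒜 where
  toEquiv := σ.toEquiv.symm
  map_one := by rw [LinearEquiv.symm_apply_eq, σ.map_one]
  map_mul x y := by
    rw [LinearEquiv.symm_apply_eq, σ.map_mul, LinearEquiv.apply_symm_apply,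
      LinearEquiv.apply_symm_apply]
  mem_iff i a := by rw [← σ.mem_iff, LinearEquiv.apply_symm_apply]

theorem map_algebraMap (σ : GradedAntiEquiv 𝒜 ℬ) (c : K) :
    σ.toEquiv (algebraMap K B c) = algebraMap K A c := by
  rw [Algebra.algebraMap_eq_smul_one, map_smul, σ.map_one, ← Algebra.algebraMap_eq_smul_one]

/-- The anti-isomorphism swaps left and right inverses. This is harmless because one-sided inverses
in a Noetherian ring are two-sided. -/
theorem map_jacobson [Module.Finite K B] (σ : GradedAntiEquiv 𝒜 ℬ) {b : B}
    (hb : b ∈ Ring.jacobson B) : σ.toEquiv b ∈ Ring.jacobson A := by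
  have : IsNoetherianRing B := isNoetherian_of_tower K inferInstance
  rw [← Ideal.jacobson_bot, Ideal.mem_jacobson_iff]
  intro y
  obtain ⟨y, rfl⟩ := σ.toEquiv.surjective y
  have h : b * y ∈ Ring.jacobson B := Ideal.mul_mem_right _ _ hb
  rw [← Ideal.jacobson_bot, Ideal.mem_jacobson_iff] at h
  obtain ⟨z, hz⟩ := h 1
  rw [Ideal.mem_bot, mul_one, sub_eq_zero, ← mul_add_one, mul_eq_one_comm] at hz
  refine ⟨σ.toEquiv z, ?_⟩
  rw [Ideal.mem_bot, mul_assoc, ← mul_add_one, ← σ.map_mul, ← σ.map_one, ← map_add, ← σ.map_mul,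
    hz, sub_self]

end GradedAntiEquiv

namespace GrMod

/-! ### The graded vector space dual -/

section

variable {K : Type u} {A B : Type v} [Field K] [Ring A] [Algebra K A] [Ring B] [Algebra K B]
  {𝒜 : ℤ → Submodule K A} {ℬ : ℤ → Submodule K B} [GradedAlgebra 𝒜] [Module.Finite K A]

omit [GradedAlgebra 𝒜] in
theorem finite_base (M : GrMod 𝒜) (hM : Module.Finite A M.carrier) : Module.Finite K M.carrier :=
  Module.Finite.trans A M.carrier

/-- A finitely generated graded module is bounded. -/
theorem exists_support (M : GrMod 𝒜) (hM : Module.Finite A M.carrier) :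
    ∃ s : Finset ℤ, ∀ m, m = ∑ i ∈ s, M.proj i m := by
  classical
  obtain ⟨t, ht⟩ := (M.finite_base hM).fg_top
  choose s hs using M.exists_sum
  refine ⟨t.biUnion s, fun m => ?_⟩
  let f : M.carrier →ₗ[K] M.carrier := ∑ i ∈ t.biUnion s, M.projLin i
  have hf : ∀ m, f m = ∑ i ∈ t.biUnion s, M.proj i m := fun m => by simp [f]
  -- Both sides are `K`-linear, so it suffices to compare them on a finite spanning set, whose
  -- supports have a finite union.
  have h : LinearMap.id = f := by
    refine LinearMap.ext_on ht fun m hm => ?_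
    rw [hf, LinearMap.id_apply]
    refine (hs m).trans (Finset.sum_subset (Finset.subset_biUnion_of_mem s hm) fun i _ hi => ?_)
    have := M.proj_sum (s m) (fun i => M.proj i m) (fun i => M.proj_mem i m) i
    rwa [← hs m, if_neg hi] at this
  rw [← hf, ← h, LinearMap.id_apply]

variable (W : Type v) [AddCommGroup W] [Module K W]

/-- The graded dual `Hom_K(M, W)` of a finitely generated graded module. -/
def dual (σ : GradedAntiEquiv 𝒜 ℬ) (M : GrMod 𝒜) (hM : Module.Finite A M.carrier) :
    GrMod ℬ where
  carrier := M.carrier →ₗ[K] W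
  module :=
    { smul := fun b f => f ∘ₗ Algebra.lsmul K K M.carrier (σ.toEquiv b)
      one_smul := fun f => LinearMap.ext fun m => by
        change f (σ.toEquiv 1 • m) = f m
        rw [σ.map_one, one_smul]
      mul_smul := fun b c f => LinearMap.ext fun m => by
        change f (σ.toEquiv (b * c) • m) = f (σ.toEquiv c • σ.toEquiv b • m)
        rw [σ.map_mul, mul_smul]
      smul_zero := fun b => LinearMap.ext fun m => rfl
      smul_add := fun b f g => LinearMap.ext fun m => rfl
      add_smul := fun b c f => LinearMap.ext fun m => by
        change f (σ.toEquiv (b + c) • m) = f (σ.toEquiv b • m) + f (σ.toEquiv c • m)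
        rw [map_add, add_smul, map_add]
      zero_smul := fun f => LinearMap.ext fun m => by
        change f (σ.toEquiv 0 • m) = 0
        rw [map_zero, zero_smul, map_zero] }
  -- Degree `k` functionals are those living on `M_{-k}`; the sign makes the action of `B` raise
  -- degrees.
  deg k :=
    { carrier := {f | ∀ i, i ≠ -k → ∀ m ∈ M.deg i, f m = 0}
      zero_mem' := fun _ _ _ _ => rfl
      add_mem' := fun {f g} hf hg i hi m hm => by
        rw [LinearMap.add_apply, hf i hi m hm, hg i hi m hm, add_zero]
      neg_mem' := fun {f} hf i hi m hm => by
        rw [LinearMap.neg_apply, hf i hi m hm, neg_zero] }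
  isInternal := by
    refine isInternal_of_sums _ (fun f => ?_) (fun s x hx h i hi => ?_)
    · obtain ⟨s, hs⟩ := M.exists_support hM
      refine ⟨s.map (Equiv.neg ℤ).toEmbedding, fun i => f ∘ₗ M.projLin (-i),
        fun k i hi m hm => ?_, LinearMap.ext fun m => ?_⟩
      · change f (M.proj (-k) m) = 0
        rw [M.proj_of_mem_ne hm hi, map_zero]
      · rw [LinearMap.sum_apply]
        conv_lhs => rw [hs m, map_sum]
        simp
    · refine LinearMap.ext fun m => ?_
      -- The functional `x i` sees only the component of degree `-i`, so evaluating the vanishing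
      -- sum there isolates it.
      have h1 : x i m = x i (M.proj (-i) m) := by
        obtain ⟨t, ht⟩ := M.exists_support hM
        have h2 : x i m = ∑ j ∈ t, x i (M.proj j m) := by
          conv_lhs => rw [ht m, map_sum]
        have h3 : x i (M.proj (-i) m) = ∑ j ∈ t, x i (M.proj j (M.proj (-i) m)) := by
          conv_lhs => rw [ht (M.proj (-i) m), map_sum]
        rw [h2, h3]
        refine Finset.sum_congr rfl fun j _ => ?_
        by_cases hj : j = -i
        · subst hj
          rw [M.proj_of_mem (M.proj_mem _ m)]
        · rw [hx i j hj _ (M.proj_mem j m), M.proj_of_mem_ne (M.proj_mem (-i) m) (Ne.symm hj),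
            map_zero]
      have h4 : (∑ j ∈ s, x j) (M.proj (-i) m) = 0 := by rw [h]; rfl
      rw [LinearMap.sum_apply, Finset.sum_eq_single i
        (fun j _ hj => hx j _ (fun h => hj (neg_injective h).symm) _ (M.proj_mem _ m))
        (fun h => (h hi).elim)] at h4
      rw [h1, h4]
      rfl
  smul_mem := fun {i j b f} hb hf l hl m hm =>
    hf (i + l) (by omega) _ (M.smul_mem ((σ.mem_iff i b).2 hb) hm)

variable {W} (σ : GradedAntiEquiv 𝒜 ℬ)

/-- The elements of the dual as linear maps. -/
def dualFun {M : GrMod 𝒜} {hM : Module.Finite A M.carrier} (f : (dual W σ M hM).carrier) :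
    M.carrier →ₗ[K] W := f

variable {σ}

theorem dual_ext {M : GrMod 𝒜} {hM : Module.Finite A M.carrier} {f g : (dual W σ M hM).carrier}
    (h : ∀ m, dualFun σ f m = dualFun σ g m) : f = g := LinearMap.ext h

theorem dualFun_smul {M : GrMod 𝒜} {hM : Module.Finite A M.carrier} (b : B)
    (f : (dual W σ M hM).carrier) (m : M.carrier) :
    dualFun σ (b • f) m = dualFun σ f (σ.toEquiv b • m) := rfl

theorem dualFun_zero {M : GrMod 𝒜} {hM : Module.Finite A M.carrier} (m : M.carrier) :
    dualFun σ (0 : (dual W σ M hM).carrier) m = 0 := rfl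

theorem mem_dual_deg {M : GrMod 𝒜} {hM : Module.Finite A M.carrier} {k : ℤ}
    {f : (dual W σ M hM).carrier} :
    f ∈ (dual W σ M hM).deg k ↔ ∀ i, i ≠ -k → ∀ m ∈ M.deg i, dualFun σ f m = 0 := Iff.rfl

/-- The dual as a vector space. -/
def dualEquiv (M : GrMod 𝒜) (hM : Module.Finite A M.carrier) :
    (dual W σ M hM).carrier ≃ₗ[K] (M.carrier →ₗ[K] W) where
  toFun := dualFun σ
  invFun f := f
  map_add' _ _ := rfl
  map_smul' c f := LinearMap.ext fun m => by
    rw [base_smul_def, dualFun_smul, σ.map_algebraMap, ← base_smul_def, map_smul]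
    rfl
  left_inv _ := rfl
  right_inv _ := rfl

theorem finite_dual [Module.Finite K W] (M : GrMod 𝒜) (hM : Module.Finite A M.carrier) :
    Module.Finite B (dual W σ M hM).carrier := by
  have := M.finite_base hM
  have := Module.Finite.equiv (dualEquiv (W := W) (σ := σ) M hM).symm
  exact Module.Finite.of_restrictScalars_finite K B _

/-- If `M_{-k} = 0` then the degree `k` part of the dual vanishes. -/
theorem dual_deg_eq_bot {M : GrMod 𝒜} {hM : Module.Finite A M.carrier} {k : ℤ}
    (h : M.deg (-k) = ⊥) : (dual W σ M hM).deg k = ⊥ := by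
  refine (AddSubgroup.eq_bot_iff_forall _).2 fun f hf => dual_ext fun m => ?_
  obtain ⟨s, hs⟩ := M.exists_sum m
  rw [hs, map_sum, dualFun_zero]
  refine Finset.sum_eq_zero fun i _ => ?_
  by_cases hi : i = -k
  · have := M.proj_mem i m
    rw [hi, h, AddSubgroup.mem_bot] at this
    rw [hi, this, map_zero]
  · exact hf i hi _ (M.proj_mem i m)

/-- The dual of a morphism. -/
def dualHom {M N : GrMod 𝒜} (f : M ⟶ N) (hM : Module.Finite A M.carrier)
    (hN : Module.Finite A N.carrier) : dual W σ N hN ⟶ dual W σ M hM :=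
  mkHom
    { toFun := fun g => dualFun σ g ∘ₗ (lin f).restrictScalars K
      map_add' := fun _ _ => rfl
      map_smul' := fun b g => dual_ext fun m => by
        change dualFun σ g (σ.toEquiv b • lin f m) = dualFun σ g (lin f (σ.toEquiv b • m))
        rw [(lin f).map_smul] }
    fun _ _ hg i hi _ hm => hg i hi _ (lin_mem f hm)

theorem dualFun_dualHom {M N : GrMod 𝒜} (f : M ⟶ N) (hM : Module.Finite A M.carrier)
    (hN : Module.Finite A N.carrier) (g : (dual W σ N hN).carrier) (m : M.carrier) :
    dualFun σ (lin (dualHom f hM hN) g) m = dualFun σ g (lin f m) := rfl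

theorem dualHom_injective {M N : GrMod 𝒜} (f : M ⟶ N) (hM : Module.Finite A M.carrier)
    (hN : Module.Finite A N.carrier) (hf : Function.Surjective (lin f)) :
    Function.Injective (lin (dualHom (W := W) (σ := σ) f hM hN)) := fun g h e =>
  dual_ext fun n => by
    obtain ⟨m, rfl⟩ := hf n
    rw [← dualFun_dualHom f hM hN, e, dualFun_dualHom]

/-- The inverses used here are only `K`-linear splittings, available because `K` is a field; that is
enough for exactness of `Hom_K(-, W)`. -/
theorem shortExact_dual {L M N : GrMod 𝒜} {f : L ⟶ M} {g : M ⟶ N} (w : f ≫ g = 0)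
    (hf : Function.Injective (lin f)) (hg : Function.Surjective (lin g))
    (hfg : ∀ m, lin g m = 0 → ∃ l, lin f l = m) (hL : Module.Finite A L.carrier)
    (hM : Module.Finite A M.carrier) (hN : Module.Finite A N.carrier) :
    ∃ w', (ShortComplex.mk (dualHom (W := W) (σ := σ) g hM hN) (dualHom f hL hM)
      w').ShortExact := by
  refine ⟨hom_ext fun h => dual_ext fun l => ?_, shortExact_of_lin _ _ _
    (dualHom_injective g hM hN hg) (fun h => ?_) (fun h hh => ?_)⟩
  · rw [lin_comp, dualFun_dualHom, dualFun_dualHom, lin_comp_eq_zero w, map_zero]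
    rfl
  · obtain ⟨r, hr⟩ := ((lin f).restrictScalars K).exists_leftInverse_of_injective
      (LinearMap.ker_eq_bot.2 hf)
    exact ⟨(dualFun σ h ∘ₗ r : M.carrier →ₗ[K] W), dual_ext fun l =>
      congrArg (dualFun σ h) (LinearMap.congr_fun hr l)⟩
  · obtain ⟨r, hr⟩ := ((lin g).restrictScalars K).exists_rightInverse_of_surjective
      (LinearMap.range_eq_top.2 hg)
    refine ⟨(dualFun σ h ∘ₗ r : N.carrier →ₗ[K] W), dual_ext fun m => ?_⟩
    change dualFun σ h (r (lin g m)) = dualFun σ h m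
    have h1 : lin g (r (lin g m) - m) = 0 := by
      rw [map_sub, sub_eq_zero]
      exact LinearMap.congr_fun hr (lin g m)
    obtain ⟨l, hl⟩ := hfg _ h1
    rw [← sub_eq_zero, ← map_sub, ← hl, ← dualFun_dualHom f hL hM, hh]
    rfl

/-- The evaluation morphism to the double dual. -/
def evalHom (M : GrMod 𝒜) (hM : Module.Finite A M.carrier)
    (hM' : Module.Finite B (dual W σ M hM).carrier) [GradedAlgebra ℬ] [Module.Finite K B] :
    M ⟶ dual W σ.symm (dual W σ M hM) hM' :=
  mkHom
    { toFun := fun m => (LinearMap.applyₗ m) ∘ₗ (dualEquiv M hM).toLinearMap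
      map_add' := fun x y => dual_ext fun f => map_add (dualFun σ f) x y
      map_smul' := fun a m => dual_ext fun f => by
        change dualFun σ f (a • m) = dualFun σ f (σ.toEquiv (σ.toEquiv.symm a) • m)
        rw [LinearEquiv.apply_symm_apply] }
    fun k m hm i hi f hf => hf k (by omega) m hm

variable (hW : Module.finrank K W = 1)

include hW

theorem exists_functional {V : Type v} [AddCommGroup V] [Module K V] {x : V} (hx : x ≠ 0) :
    ∃ f : V →ₗ[K] W, f x ≠ 0 := by
  have := Module.nontrivial_of_finrank_pos (R := K) (M := W) (by omega)
  obtain ⟨w, hw⟩ := exists_ne (0 : W)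
  obtain ⟨f, hf⟩ : ∃ f : Module.Dual K V, f x ≠ 0 := by
    by_contra! h
    exact hx ((Module.forall_dual_apply_eq_zero_iff K x).1 h)
  exact ⟨f.smulRight w, smul_ne_zero hf hw⟩

theorem evalHom_injective [GradedAlgebra ℬ] [Module.Finite K B] (M : GrMod 𝒜)
    (hM : Module.Finite A M.carrier) (hM' : Module.Finite B (dual W σ M hM).carrier) :
    Function.Injective (lin (evalHom (σ := σ) M hM hM')) := by
  rw [injective_iff_map_eq_zero]
  intro m hm
  by_contra h
  obtain ⟨f, hf⟩ := exists_functional hW h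
  exact hf (congrArg (fun e => dualFun σ.symm e (f : (dual W σ M hM).carrier)) hm)

/-- Evaluation is injective, and `dim W = 1` makes the dimensions equal. -/
theorem nonempty_iso_double_dual [GradedAlgebra ℬ] [Module.Finite K B] (M : GrMod 𝒜)
    (hM : Module.Finite A M.carrier) (hM' : Module.Finite B (dual W σ M hM).carrier) :
    Nonempty (M ≅ dual W σ.symm (dual W σ M hM) hM') := by
  have hinj := evalHom_injective (σ := σ) hW M hM hM'
  have hfin := M.finite_base hM
  have hfin' := finite_base _ hM'
  have := Module.finite_of_finrank_pos (R := K) (M := W) (by omega)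
  have := Module.Finite.equiv (dualEquiv (W := W) (σ := σ.symm) _ hM').symm
  refine nonempty_iso_of_bijective _ ⟨hinj, (LinearMap.injective_iff_surjective_of_finrank_eq_finrank
    (f := (lin (evalHom M hM hM')).restrictScalars K) ?_).1 hinj⟩
  rw [(dualEquiv (W := W) (σ := σ.symm) _ hM').finrank_eq, Module.finrank_linearMap, hW,
    (dualEquiv (W := W) (σ := σ) _ hM).finrank_eq, Module.finrank_linearMap, hW, mul_one, mul_one]

end

section

variable {K : Type u} {A : Type v} [Field K] [Ring A] [Algebra K A]
  {𝒜 : ℤ → Submodule K A} [GradedAlgebra 𝒜] [Module.Finite K A] [IsNonnegGraded 𝒜]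

/-! ### Morphisms from the shifts of the top -/

omit [Module.Finite K A] in
theorem regular_deg_eq_bot {i : ℤ} (hi : i < 0) : (regular 𝒜).deg i = ⊥ := by
  change (𝒜 i).toAddSubgroup = ⊥
  rw [IsNonnegGraded.eq_bot (𝒜 := 𝒜) i hi]
  rfl

/-- The residue class of `1`. -/
def topOne (i : ℤ) : ((top 𝒜).shift i).carrier := (Ring.jacobson A).mkQ 1

theorem topOne_mem (i : ℤ) : topOne i ∈ ((top 𝒜).shift i).deg (-i) := by
  change (Ring.jacobson A).mkQ (1 : A) ∈ (top 𝒜).deg (-i + i)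
  rw [neg_add_cancel]
  exact ⟨(1 : A), SetLike.one_mem_graded 𝒜, rfl⟩

theorem smul_topOne (i : ℤ) (a : A) :
    a • topOne (𝒜 := 𝒜) i = (Ring.jacobson A).mkQ a := by
  refine ((Ring.jacobson A).mkQ.map_smul a 1).symm.trans ?_
  rw [smul_eq_mul, mul_one]

theorem top_hom_ext {i : ℤ} {M : GrMod 𝒜} {f g : (top 𝒜).shift i ⟶ M}
    (h : lin f (topOne i) = lin g (topOne i)) : f = g :=
  hom_ext fun x => by
    obtain ⟨a, ha⟩ := (Ring.jacobson A).mkQ_surjective x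
    rw [← ha, ← smul_topOne i, map_smul, map_smul, h]

theorem jacobson_smul_topOne (i : ℤ) {a : A} (ha : a ∈ Ring.jacobson A) :
    a • topOne (𝒜 := 𝒜) i = 0 := by
  rw [smul_topOne]
  exact (Submodule.Quotient.mk_eq_zero _).2 ha

/-- Homogeneous elements annihilated by the radical determine morphisms from shifts of the top. -/
theorem exists_hom_of_socle (M : GrMod 𝒜) {i : ℤ} {x : M.carrier} (hx : x ∈ M.deg (-i))
    (h : ∀ a ∈ Ring.jacobson A, a • x = 0) :
    ∃ f : (top 𝒜).shift i ⟶ M, lin f (topOne i) = x := by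
  refine ⟨mkHom (M := (top 𝒜).shift i) ((Ring.jacobson A).liftQ
    (LinearMap.toSpanSingleton A M.carrier x) fun a ha => LinearMap.mem_ker.2 (h a ha)) ?_, ?_⟩
  · rintro j _ ⟨a, ha, rfl⟩
    have := M.smul_mem (i := j + i) (a := a) ha hx
    rwa [add_neg_cancel_right] at this
  · exact one_smul A x

/-- Positive degrees of `A` lie in the radical and negative degrees vanish, so `A / J_A` is
concentrated in degree `0`. -/
theorem top_shift_deg_eq_bot {i j : ℤ} (h : j ≠ -i) : ((top 𝒜).shift i).deg j = ⊥ := by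
  refine (AddSubgroup.eq_bot_iff_forall _).2 ?_
  rintro _ ⟨a, ha, rfl⟩
  refine (Submodule.Quotient.mk_eq_zero _).2 ?_
  rcases lt_or_gt_of_ne (show j + i ≠ 0 by omega) with h | h
  · rw [regular_deg_eq_bot h, SetLike.mem_coe, AddSubgroup.mem_bot] at ha
    rw [ha]
    exact (Ring.jacobson A).zero_mem
  · exact mem_jacobson_of_pos 𝒜 h ha

theorem finite_top_shift (i : ℤ) : Module.Finite A ((top 𝒜).shift i).carrier :=
  inferInstanceAs (Module.Finite A (A ⧸ Ring.jacobson A))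

end

/-! ### Socles of duals, generators, and injective duals of free modules -/

section

variable {K : Type u} {A B : Type v} [Field K] [Ring A] [Algebra K A] [Ring B] [Algebra K B]
  {𝒜 : ℤ → Submodule K A} {ℬ : ℤ → Submodule K B} [GradedAlgebra 𝒜] [GradedAlgebra ℬ]
  [Module.Finite K A] [Module.Finite K B] [IsNonnegGraded 𝒜] [IsNonnegGraded ℬ]
  {W : Type v} [AddCommGroup W] [Module K W] {σ : GradedAntiEquiv 𝒜 ℬ}

/-- If the socle of the dual of `L` lives in degrees `≥ -k` then `L` is generated in degrees
`≤ k`. -/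
theorem span_eq_top_of_dual (hW : Module.finrank K W = 1) (L : GrMod 𝒜)
    (hL : Module.Finite A L.carrier) (k : ℤ)
    (h : ∀ i, k < i → ∀ f : (top ℬ).shift i ⟶ dual W σ L hL, f = 0) :
    Submodule.span A {x | ∃ j ∈ Set.Iic k, x ∈ L.deg j} = ⊤ := by
  by_contra hne
  set H := Submodule.span A {x | ∃ j ∈ Set.Iic k, x ∈ L.deg j}
  have : Nontrivial (L.carrier ⧸ H) := Submodule.Quotient.nontrivial_iff.2 hne
  -- Nakayama: if `H` is proper, so is `H' = H + J_A L`.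
  have hlt : Ring.jacobson A • (⊤ : Submodule A (L.carrier ⧸ H)) < ⊤ :=
    Submodule.jacobson_smul_lt_top ⊤
  set H' := (Ring.jacobson A • (⊤ : Submodule A (L.carrier ⧸ H))).comap H.mkQ
  have hJ : ∀ a ∈ Ring.jacobson A, ∀ x : L.carrier, a • x ∈ H' := fun a ha x => by
    rw [Submodule.mem_comap, map_smul]
    exact Submodule.smul_mem_smul ha trivial
  have hHH : H ≤ H' := fun x hx => by
    rw [Submodule.mem_comap, Submodule.mkQ_apply, (Submodule.Quotient.mk_eq_zero H).2 hx]
    exact Submodule.zero_mem _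
  have hH' : H' ≠ ⊤ := fun e => hlt.ne (by
    rw [← Submodule.map_comap_eq_of_surjective H.mkQ_surjective (Ring.jacobson A • ⊤)]
    change H'.map H.mkQ = ⊤
    rw [e, Submodule.map_top, Submodule.range_mkQ])
  obtain ⟨j, x, hxj, hx⟩ : ∃ j, ∃ x ∈ L.deg j, x ∉ H' := by
    by_contra! hall
    refine hH' (eq_top_iff.2 fun x _ => ?_)
    obtain ⟨s, hs⟩ := L.exists_sum x
    rw [hs]
    exact Submodule.sum_mem _ fun i _ => hall i _ (L.proj_mem i x)
  have hkj : k < j := by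
    by_contra! hjk
    exact hx (hHH (Submodule.subset_span ⟨j, hjk, hxj⟩))
  obtain ⟨f, hf⟩ := exists_functional (K := K) hW (x := (H'.restrictScalars K).mkQ x)
    (fun e => hx ((Submodule.Quotient.mk_eq_zero (H'.restrictScalars K)).1 e))
  have hfH : ∀ y ∈ H', f ((H'.restrictScalars K).mkQ y) = 0 := fun y hy => by
    rw [show (H'.restrictScalars K).mkQ y = 0 from (Submodule.Quotient.mk_eq_zero _).2 hy,
      map_zero]
  -- A functional on `L_j` killing `H'` is a socle element of `D L` of degree `-j`. It yields a
  -- nonzero morphism from `(B / J_B)(j)` with `j > k`, a contradiction.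
  let φ : (dual W σ L hL).carrier := f ∘ₗ (H'.restrictScalars K).mkQ ∘ₗ L.projLin j
  have hφ : ∀ m, dualFun σ φ m = f ((H'.restrictScalars K).mkQ (L.proj j m)) := fun _ => rfl
  have hφdeg : φ ∈ (dual W σ L hL).deg (-j) := mem_dual_deg.2 fun i hi m hm => by
    rw [hφ, L.proj_of_mem_ne hm (by omega), map_zero, map_zero]
  have hφJ : ∀ b ∈ Ring.jacobson B, b • φ = 0 := fun b hb => dual_ext fun m => by
    rw [dualFun_smul, dualFun_zero]
    have ha := σ.map_jacobson hb
    generalize σ.toEquiv b = a at ha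
    -- Only products of components with total degree `j` matter to `φ`. As `J_A` is homogeneous,
    -- each of these lies in `J_A L ⊆ H'`.
    obtain ⟨s, hs⟩ := (regular 𝒜).exists_sum a
    obtain ⟨t, ht⟩ := L.exists_sum m
    have hsm : a • m = ∑ i ∈ s, ∑ l ∈ t, (show A from (regular 𝒜).proj i a) • L.proj l m := by
      conv_lhs => rw [hs, ht]
      exact Finset.sum_smul_sum s t
    rw [hsm, map_sum]
    refine Finset.sum_eq_zero fun i _ => ?_
    rw [map_sum]
    refine Finset.sum_eq_zero fun l _ => ?_
    have h1 := L.smul_mem (a := (show A from (regular 𝒜).proj i a))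
      ((regular 𝒜).proj_mem i a) (L.proj_mem l m)
    rw [hφ]
    by_cases hil : i + l = j
    · rw [← hil, L.proj_of_mem h1]
      exact hfH _ (hJ _ (isHomog_jacobson 𝒜 a ha i) _)
    · rw [L.proj_of_mem_ne h1 hil, map_zero, map_zero]
  obtain ⟨g, hg⟩ := exists_hom_of_socle _ hφdeg hφJ
  rw [h j hkj g, lin_zero] at hg
  refine hf ?_
  have := hφ x
  rw [← hg, dualFun_zero, L.proj_of_mem hxj] at this
  exact this.symm

omit [Module.Finite K B] [IsNonnegGraded 𝒜] [IsNonnegGraded ℬ] in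
/-- The dual of a shifted regular module is injective. -/
theorem injective_dual_shift_regular (j : ℤ)
    (hA : Module.Finite A ((regular 𝒜).shift (-j)).carrier) :
    Injective (dual W σ ((regular 𝒜).shift (-j)) hA) where
  factors {X Y} g ι hι := by
    have hinj := injective_of_mono ι
    -- Evaluation at the generator turns a morphism into the dual of `A(-j)` into a functional on
    -- `X_{-j}`. Such a functional extends along `ι` over the field `K`, and the extension `μ` is
    -- converted back into a morphism.
    let lam : X.carrier →ₗ[K] W :=
      { toFun := fun x => dualFun σ (lin g x) (shiftOne j)
        map_add' := fun x y => by rw [map_add]; rfl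
        map_smul' := fun c x => by
          rw [base_smul_def, map_smul, dualFun_smul, σ.map_algebraMap, ← base_smul_def, map_smul]
          rfl }
    have hlam : ∀ x, lam x = dualFun σ (lin g x) (shiftOne j) := fun _ => rfl
    have hlam' : ∀ x, lam (X.proj (-j) x) = lam x := fun x => by
      obtain ⟨s, hs⟩ := X.exists_sum x
      have h0 : ∀ i, i ≠ -j → lam (X.proj i x) = 0 := fun i hi =>
        lin_mem g (X.proj_mem i x) j (by omega) _ (shiftOne_mem j)
      have hx : lam x = ∑ i ∈ s, lam (X.proj i x) := by
        conv_lhs => rw [hs, map_sum]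
      by_cases hj : -j ∈ s
      · rw [hx, Finset.sum_eq_single_of_mem _ hj fun i _ hi => h0 i hi]
      · have := X.proj_sum s (fun i => X.proj i x) (fun i => X.proj_mem i x) (-j)
        rw [← hs, if_neg hj] at this
        rw [this, map_zero, hx]
        exact (Finset.sum_eq_zero fun i hi => h0 i (fun e => hj (e ▸ hi))).symm
    obtain ⟨r, hr⟩ := ((lin ι).restrictScalars K).exists_leftInverse_of_injective
      (LinearMap.ker_eq_bot.2 hinj)
    let μ : Y.carrier →ₗ[K] W := lam ∘ₗ r ∘ₗ Y.projLin (-j)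
    have hμι : ∀ x, μ (lin ι x) = lam x := fun x => by
      change lam (r (Y.proj (-j) (lin ι x))) = lam x
      rw [proj_lin, ← hlam' x]
      exact congrArg lam (LinearMap.congr_fun hr _)
    have hμ : ∀ i, i ≠ -j → ∀ y ∈ Y.deg i, μ y = 0 := fun i hi y hy => by
      change lam (r (Y.proj (-j) y)) = 0
      rw [Y.proj_of_mem_ne hy hi, map_zero, map_zero]
    let h : Y ⟶ dual W σ ((regular 𝒜).shift (-j)) hA := mkHom
      { toFun := fun y =>
          { toFun := fun a => μ (σ.symm.toEquiv a • y)
            map_add' := fun a b => by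
              rw [← map_add, ← add_smul]
              exact congrArg (fun c : B => μ (c • y)) (map_add σ.symm.toEquiv a b)
            map_smul' := fun c a => by
              have h2 : σ.symm.toEquiv (algebraMap K A c * (show A from a))
                  = c • σ.symm.toEquiv (show A from a) := by
                rw [← Algebra.smul_def, map_smul]
              change μ (σ.symm.toEquiv (algebraMap K A c * (show A from a)) • y)
                = c • μ (σ.symm.toEquiv (show A from a) • y)
              rw [h2, smul_assoc, map_smul] }
        map_add' := fun x y => dual_ext fun a => by
          change μ (σ.symm.toEquiv a • (x + y)) = _
          rw [smul_add, map_add]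
          rfl
        map_smul' := fun b y => dual_ext fun a => by
          change μ (σ.symm.toEquiv a • b • y)
            = μ (σ.symm.toEquiv (σ.toEquiv b * (show A from a)) • y)
          rw [σ.symm.map_mul, mul_smul]
          congr 3
          exact (LinearEquiv.symm_apply_apply _ _).symm }
      fun i y hy l hl a ha => by
        have h1 : σ.symm.toEquiv (show A from a) ∈ ℬ (l + -j) :=
          (σ.symm.mem_iff (l + -j) (show A from a)).2 ha
        exact hμ (l + -j + i) (by omega) _ (Y.smul_mem h1 hy)
    refine ⟨h, hom_ext fun x => dual_ext fun a => ?_⟩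
    change μ (σ.symm.toEquiv (show A from a) • lin ι x) = dualFun σ (lin g x) a
    rw [← map_smul, hμι, hlam, map_smul, dualFun_smul]
    refine congrArg (dualFun σ (lin g x)) ?_
    change σ.toEquiv (σ.toEquiv.symm (show A from a)) * (1 : A) = _
    rw [mul_one, LinearEquiv.apply_symm_apply]

/-- For one summand, injectivity leaves only morphisms. One sends the generator to a functional on
`A_{i-j}` annihilated by `J_B`. Since `i > k ≥ j`, each `c` in `A_{i-j}` lies in `J_A`, and the
value at `c` is that of the annihilated functional `σ⁻¹(c) • φ` at `1`. -/
theorem IsFreeOn.extZero_dual {k : ℤ} {P : GrMod 𝒜} (hP : IsFreeOn (Set.Iic k) P)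
    (hfin : Module.Finite A P.carrier) {i : ℤ} (hi : k < i) (n : ℕ) :
    ExtZero n ((top ℬ).shift i) (dual W σ P hfin) := by
  induction hP with
  | zero =>
    refine ExtVanishing.of_isZero_right (isZero_of_subsingleton ⟨fun f g => dual_ext fun m => ?_⟩) _
    rw [show m = 0 from rfl, map_zero, map_zero]
  | cons hj hP ih =>
    rename_i j P
    have hP' := hP.finite
    have hA : Module.Finite A ((regular 𝒜).shift (-j)).carrier :=
      inferInstanceAs (Module.Finite A A)
    obtain ⟨w, hS⟩ := shortExact_dual (W := W) (σ := σ)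
      (prodBicone ((regular 𝒜).shift (-j)) P).inl_snd
      (LinearMap.inl_injective (R := A) (M := A) (M₂ := P.carrier))
      (LinearMap.snd_surjective (R := A) (M := A) (M₂ := P.carrier))
      (fun m hm => ⟨m.1, Prod.ext rfl hm.symm⟩) hA hfin hP'
    refine ExtVanishing.covariant_middle hS (ih hP') ?_
    cases n with
    | succ n =>
      have := injective_dual_shift_regular (W := W) (σ := σ) j hA
      exact Abelian.Ext.subsingleton_of_injective _ _ _
    | zero =>
      refine ExtVanishing.zero_iff.2 fun f => top_hom_ext ?_
      refine dual_ext (M := (regular 𝒜).shift (-j)) (hM := hA) fun a => ?_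
      rw [lin_zero, dualFun_zero]
      have hφ := lin_mem f (topOne_mem i)
      obtain ⟨s, hs⟩ := ((regular 𝒜).shift (-j)).exists_sum a
      rw [hs, map_sum]
      refine Finset.sum_eq_zero fun l _ => ?_
      have hl := ((regular 𝒜).shift (-j)).proj_mem l a
      generalize ((regular 𝒜).shift (-j)).proj l a = c at hl
      by_cases hli : l = i
      · have hJ : (show A from c) ∈ Ring.jacobson A :=
          mem_jacobson_of_pos 𝒜 (i := l + -j) (by have := Set.mem_Iic.1 hj; omega) hl
        have h1 : σ.symm.toEquiv (show A from c) • lin f (topOne i) = 0 := by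
          rw [← map_smul, jacobson_smul_topOne i (σ.symm.map_jacobson hJ), map_zero]
        have h2 := congrArg (fun g => dualFun (M := (regular 𝒜).shift (-j)) (hM := hA) σ g
          (shiftOne j)) h1
        refine Eq.trans (congrArg (dualFun (M := (regular 𝒜).shift (-j)) (hM := hA) σ
          (lin f (topOne i))) ?_) h2
        change (show A from c) = σ.toEquiv (σ.toEquiv.symm (show A from c)) * (1 : A)
        rw [mul_one, LinearEquiv.apply_symm_apply]
      · exact hφ l (by omega) c hl

end

/-! ### Transfer of vanishing across the duality -/

section

variable {K : Type u} {A B : Type v} [Field K] [Ring A] [Algebra K A] [Ring B] [Algebra K B]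
  {𝒜 : ℤ → Submodule K A} {ℬ : ℤ → Submodule K B} [GradedAlgebra 𝒜] [GradedAlgebra ℬ]
  [Module.Finite K A] [Module.Finite K B] [IsNonnegGraded 𝒜] [IsNonnegGraded ℬ]
  {W : Type v} [AddCommGroup W] [Module K W] {σ : GradedAntiEquiv 𝒜 ℬ}

/-- If all extensions of `(B / J_B)(i)`, `i > k`, by the dual of `L` vanish, then all extensions
of `L` by modules living in degrees `> k` vanish. -/
theorem extZero_of_dual (hW : Module.finrank K W = 1) {k : ℤ} {M : GrMod 𝒜}
    (hM : ∀ j ≤ k, M.deg j = ⊥) (n : ℕ) (L : GrMod 𝒜) (hL : Module.Finite A L.carrier)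
    (h : ∀ n i, k < i → ExtZero n ((top ℬ).shift i) (dual W σ L hL)) : ExtZero n L M := by
  have hspan := span_eq_top_of_dual hW L hL k fun i hi => ExtVanishing.zero_iff.1 (h 0 i hi)
  obtain ⟨P, hP, p, hp⟩ := exists_free_cover _ L hspan
  have hPfin := hP.finite
  have hPM := hP.extZero (M := M) hM
  induction n generalizing L P with
  | zero =>
    refine ExtVanishing.zero_iff.2 fun f => hom_ext fun m => ?_
    obtain ⟨x, rfl⟩ := hp m
    exact congrArg (fun g => lin g x) (ExtVanishing.zero_iff.1 (hPM 0) (p ≫ f))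
  | succ n ih =>
    have hK := finite_kerObj p
    obtain ⟨w, hS⟩ := shortExact_dual (W := W) (σ := σ) (kerι_comp p) Subtype.val_injective hp
      (fun m hm => ⟨⟨m, hm⟩, rfl⟩) hK hPfin hL
    -- The dual of `ker p` is the cokernel of `D L → D P`. As `D P` has no extensions by these
    -- shifts of the top on the left, the hypothesis on `D L` in degree `n + 1` gives the one for
    -- the syzygy in degree `n`.
    have hKdual : ∀ n i, k < i → ExtZero n ((top ℬ).shift i) (dual W σ (kerObj p) hK) :=
      fun n i hi => ExtVanishing.covariant_right hS (hP.extZero_dual hPfin hi n) (h (n + 1) i hi)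
    have hKspan := span_eq_top_of_dual hW _ hK k
      fun i hi => ExtVanishing.zero_iff.1 (hKdual 0 i hi)
    obtain ⟨Q, hQ, q, hq⟩ := exists_free_cover _ (kerObj p) hKspan
    exact ExtVanishing.contravariant_right (shortExact_kerι p hp)
      (ih _ hK hKdual hKspan Q hQ q hq hQ.finite (hQ.extZero hM)) (hPM (n + 1))

/-- Vanishing of extensions by the regular right module gives vanishing of the extensions of the
dual of the regular right module by the regular left module. -/
theorem extZero_dual_shift_regular (σ : GradedAntiEquiv 𝒜 ℬ) (hW : Module.finrank K W = 1)
    (h : ∀ n i, 0 < i → ExtZero n ((top ℬ).shift i) (regular ℬ)) {j : ℤ} (hj : 0 < j)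
    (hB : Module.Finite B ((regular ℬ).shift (-j)).carrier) (n : ℕ) :
    ExtZero n (dual W σ.symm ((regular ℬ).shift (-j)) hB) (regular 𝒜) := by
  have := Module.finite_of_finrank_pos (R := K) (M := W) (by omega)
  have hD : Module.Finite A (dual W σ.symm ((regular ℬ).shift (-j)) hB).carrier :=
    finite_dual _ hB
  refine extZero_of_dual (σ := σ) hW (k := -j) (fun l hl => regular_deg_eq_bot (by omega)) n _ hD
    fun m i hi => ?_
  obtain ⟨e⟩ := nonempty_iso_double_dual (σ := σ.symm) hW ((regular ℬ).shift (-j)) hB hD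
  refine ExtVanishing.of_iso_right e ?_
  -- Here `i > -j`, so `(B / J_B)(i)` is the shift by `-j` of `(B / J_B)(i + j)` with `i + j > 0`,
  -- where the hypothesis applies.
  obtain ⟨e'⟩ := nonempty_iso_shift_add (top ℬ) (i + j) (-j)
  rw [add_neg_cancel_right] at e'
  exact ExtVanishing.of_iso_left e'
    (extZero_shift m _ _ (finite_top_shift (i + j)) (-j) (h m (i + j) (by omega)))

theorem IsFreeOn.extZero_dual_regular (σ : GradedAntiEquiv 𝒜 ℬ) (hW : Module.finrank K W = 1)
    (h : ∀ n i, 0 < i → ExtZero n ((top ℬ).shift i) (regular ℬ)) {P : GrMod ℬ}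
    (hP : IsFreeOn (Set.Ioi 0) P) (hfin : Module.Finite B P.carrier) (n : ℕ) :
    ExtZero n (dual W σ.symm P hfin) (regular 𝒜) := by
  induction hP with
  | zero =>
    refine ExtVanishing.of_isZero_left (isZero_of_subsingleton ⟨fun f g => dual_ext fun m => ?_⟩) _
    rw [show m = 0 from rfl, map_zero, map_zero]
  | cons hj hP ih =>
    rename_i j P
    have hB : Module.Finite B ((regular ℬ).shift (-j)).carrier :=
      inferInstanceAs (Module.Finite B B)
    obtain ⟨w, hS⟩ := shortExact_dual (W := W) (σ := σ.symm)
      (prodBicone ((regular ℬ).shift (-j)) P).inl_snd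
      (LinearMap.inl_injective (R := B) (M := B) (M₂ := P.carrier))
      (LinearMap.snd_surjective (R := B) (M := B) (M₂ := P.carrier))
      (fun m hm => ⟨m.1, Prod.ext rfl hm.symm⟩) hB hfin hP.finite
    exact ExtVanishing.contravariant_middle hS (ih hP.finite)
      (extZero_dual_shift_regular σ hW h hj hB n)

omit [Module.Finite K B] in
theorem IsFreeOn.deg_eq_bot {P : GrMod ℬ} (hP : IsFreeOn (Set.Ioi 0) P) {l : ℤ} (hl : l ≤ 0) :
    P.deg l = ⊥ := by
  induction hP with
  | zero => exact (AddSubgroup.eq_bot_iff_forall _).2 fun _ _ => rfl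
  | cons hj hP ih =>
    rename_i j P
    refine (AddSubgroup.eq_bot_iff_forall _).2 fun x hx => Prod.ext ?_ ?_
    · have h1 : (regular ℬ).deg (l + -j) = ⊥ :=
        regular_deg_eq_bot (by have := Set.mem_Ioi.1 hj; omega)
      exact (AddSubgroup.eq_bot_iff_forall _).1 h1 _ hx.1
    · exact (AddSubgroup.eq_bot_iff_forall _).1 ih _ hx.2

/-- A finitely generated module in negative degrees embeds into a module of the same kind all of
whose extensions by the regular module vanish. -/
theorem exists_embedding (σ : GradedAntiEquiv 𝒜 ℬ) (hW : Module.finrank K W = 1)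
    (h : ∀ n i, 0 < i → ExtZero n ((top ℬ).shift i) (regular ℬ)) (S : GrMod 𝒜)
    (hS : Module.Finite A S.carrier) (hdeg : ∀ j, 0 ≤ j → S.deg j = ⊥) :
    ∃ I : GrMod 𝒜, Module.Finite A I.carrier ∧ (∀ j, 0 ≤ j → I.deg j = ⊥) ∧
      (∀ n, ExtZero n I (regular 𝒜)) ∧ ∃ f : S ⟶ I, Function.Injective (lin f) := by
  have := Module.finite_of_finrank_pos (R := K) (M := W) (by omega)
  have hD : Module.Finite B (dual W σ S hS).carrier := finite_dual _ hS
  have hspan : Submodule.span B {x | ∃ j ∈ Set.Ioi 0, x ∈ (dual W σ S hS).deg j} = ⊤ := by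
    rw [eq_top_iff, ← span_homogeneous]
    refine Submodule.span_le.2 fun x ⟨j, _, hx⟩ => ?_
    rcases lt_or_ge 0 j with hj | hj
    · exact Submodule.subset_span ⟨j, hj, hx⟩
    · rw [dual_deg_eq_bot (hdeg (-j) (by omega)), AddSubgroup.mem_bot] at hx
      rw [hx]
      exact Submodule.zero_mem _
  obtain ⟨F, hF, p, hp⟩ := exists_free_cover _ _ hspan
  -- The embedding is evaluation into the double dual followed by the dual of the cover `F → D S`.
  refine ⟨dual W σ.symm F hF.finite, finite_dual _ _,
    fun j hj => dual_deg_eq_bot (hF.deg_eq_bot (by omega)),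
    fun n => hF.extZero_dual_regular σ hW h _ n,
    evalHom S hS hD ≫ dualHom p hF.finite hD, ?_⟩
  exact (dualHom_injective p hF.finite hD hp).comp (evalHom_injective hW S hS hD)

/-- If the graded left module `A` has finite injective dimension and the extensions of
`(B / J_B)(i)`, `i > 0`, by `B` vanish, then the extensions of all finitely generated modules in
negative degrees by `A` vanish. -/
theorem extZero_regular (σ : GradedAntiEquiv 𝒜 ℬ) (hW : Module.finrank K W = 1)
    (h : ∀ n i, 0 < i → ExtZero n ((top ℬ).shift i) (regular ℬ)) {d : ℕ}
    (hd : HasInjectiveDimensionLE (regular 𝒜) d) (m : ℕ) : ∀ (n : ℕ), d + 1 ≤ n + m →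
    ∀ (S : GrMod 𝒜), Module.Finite A S.carrier → (∀ j, 0 ≤ j → S.deg j = ⊥) →
    ExtZero n S (regular 𝒜) := by
  -- Descending induction on `n`, with `m` bounding its distance to `d + 1`, from where on injective
  -- dimension forces vanishing.
  induction m with
  | zero => exact fun n hn S _ _ => HasInjectiveDimensionLT.subsingleton _ (d + 1) n hn S
  | succ m ih =>
    intro n hn S hS hdeg
    obtain ⟨I, hI, hIdeg, hIext, f, hf⟩ := exists_embedding σ hW h S hS hdeg
    refine ExtVanishing.contravariant_left (shortExact_cokerπ f hf) (hIext n)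
      (ih (n + 1) (by omega) _ (Module.Finite.quotient A (LinearMap.range (lin f))) fun j hj => ?_)
    refine (AddSubgroup.eq_bot_iff_forall _).2 ?_
    rintro _ ⟨x, hx, rfl⟩
    rw [hIdeg j hj, SetLike.mem_coe, AddSubgroup.mem_bot] at hx
    rw [hx]
    exact map_zero _

/-- One implication of the left-right symmetry. -/
theorem extZero_regular_of_antiEquiv (σ : GradedAntiEquiv 𝒜 ℬ)
    (h : ∀ n i, 0 < i → ExtZero n ((top ℬ).shift i) (regular ℬ)) {d : ℕ}
    (hd : HasInjectiveDimensionLE (regular 𝒜) d) (n : ℕ) (i : ℤ) (hi : 0 < i) :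
    ExtZero n ((top 𝒜).shift i) (regular 𝒜) := by
  rcases subsingleton_or_nontrivial A with hA | hA
  · exact ExtVanishing.of_isZero_right (isZero_of_subsingleton hA) n
  -- The line `K · 1` in `A` is a one-dimensional space in the universe of `A`, as the dual
  -- requires; it needs `A ≠ 0`. Taking `m = d + 1` covers every `n`.
  · exact extZero_regular (W := (⊥ : Subalgebra K A)) σ Subalgebra.finrank_bot h hd (d + 1) n
      (by omega) _ (finite_top_shift i) fun j hj => top_shift_deg_eq_bot (by omega)

omit [Module.Finite K B] [IsNonnegGraded ℬ] [GradedAlgebra ℬ] in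
theorem g_le_zero_iff (M : GrMod 𝒜) :
    M.g ≤ 0 ↔ ∀ n i, 0 < i → ExtZero n ((top 𝒜).shift i) M := by
  rw [g, sSup_le_iff]
  constructor
  · intro h n i hi
    rw [← not_extNeZero_iff]
    intro hne
    have h1 := h _ ⟨i, rfl, n, hne⟩
    rw [← EReal.coe_zero, EReal.coe_le_coe_iff] at h1
    exact absurd (Int.cast_nonpos.1 h1) (not_le.2 hi)
  · rintro h _ ⟨i, rfl, n, hne⟩
    rw [← EReal.coe_zero, EReal.coe_le_coe_iff]
    refine Int.cast_nonpos.2 (not_lt.1 fun hi => ?_)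
    exact not_extNeZero_iff.2 (h n i hi) hne

end

end GrMod

namespace GradedAntiEquiv

variable {K : Type u} {A : Type v} [Field K] [Ring A] [Algebra K A]

/-- The canonical anti-isomorphism between a graded algebra and its opposite. -/
def opposite (𝒜 : ℤ → Submodule K A) : GradedAntiEquiv (opGrading 𝒜) 𝒜 where
  toEquiv := MulOpposite.opLinearEquiv K
  map_one := rfl
  map_mul _ _ := rfl
  mem_iff _ _ := mem_opGrading

end GradedAntiEquiv

end

theorem mainTheorem8 {K : Type u} {A : Type v} [Field K] [Ring A] [Algebra K A]
    [Module.Finite K A] (𝒜 : ℤ → Submodule K A) [GradedAlgebra 𝒜] [IsNonnegGraded 𝒜]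
    (hIG : IsGradedIG 𝒜) (hgl : HasFiniteGlobalDimension (𝒜 0)) :
    gInvariant 𝒜 ≤ 0 ↔ gInvariantOp 𝒜 ≤ 0 := by
  obtain ⟨d, hr, hl⟩ := hIG
  rw [gInvariant, gInvariantOp, GrMod.g_le_zero_iff, GrMod.g_le_zero_iff]
  -- Each implication uses the injective dimension on the side where vanishing is to be proved.
  exact ⟨fun h => GrMod.extZero_regular_of_antiEquiv (GradedAntiEquiv.opposite 𝒜).symm h hl,
    fun h => GrMod.extZero_regular_of_antiEquiv (GradedAntiEquiv.opposite 𝒜) h hr⟩
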